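/- **Delaying the Future in TSO.** *Model.* There are processes $1,\dots,n$, each with a local dispatcher $d_i$; the processes and the dispatchers are the agents. A TSO state consists of a memory $\mathsf m:\mathsf{Var}\to\mathsf{Val}$ and a FIFO store buffer $\mathsf{buf}_i\in(\mathsf{Var}\times\mathsf{Val})^*$ for every $i$. A process $i$ can perform: $\mathtt W[x,v]$ (append $\langle x,v\rangle$ to $\mathsf{buf}_i$); $\mathtt R[x]$ (an event $\mathtt{RfB}(x,v)$ if $\langle x,v\rangle$ is the latest item for $x$ in $\mathsf{buf}_i$, and an event $\mathtt{RfM}(x,\mathsf m(x))$ if $\mathsf{buf}_i$ has no item for $x$); $\mathtt F$ (enabled iff $\mathsf{buf}_i$ is empty); $\mathtt{RMW}[x,v,w]$ (enabled iff $\mathsf{buf}_i$ is empty and $\mathsf m(x)=v$; sets $\mathsf m(x):=w$); internal actions; and the null action $\bot$. The dispatcher $d_i$ can perform $\mathtt{prop}$ (enabled iff $\mathsf{buf}_i$ is nonempty; removes the oldest item $\langle x,v\rangle$ and sets $\mathsf m(x):=v$) or $\bot$. The events $\mathtt{RMW}(x,\cdot,\cdot)$, $\mathtt{prop}(x,\cdot)$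 and $\mathtt{RfM}(x,\cdot)$ are the memory accesses of $x$. Two events are conflicting if they are memory accesses of the same variable, are not both $\mathtt{RfM}$, and are not a $\mathtt{prop}$ at some $d_i$ together with an $\mathtt{RfM}$ at the same $i$. A run is an infinite sequence $r(0),r(1),\dots$ of global states (a TSO state and a local state $r_i(t)$ for every process $i$), with empty buffers and empty local states at time $0$, where $r(t+1)$ results from $r(t)$ by a joint action performed at time $t$. The joint action has one action for every agent, each enabled at $r(t)$, and at most one invocation of an operation for every process; no two of its events at distinct agents conflict. Within a round the actions take effect one by one, first those of the dispatchers, then those of the processes. (The other order would produce the same sequences of states; the order only decides that a read by $i$ of an item that $d_i$ propagates in the same round, and that is the latest item for its variable in $\mathsf{buf}_i$, counts as an $\mathtt{RfM}$.) The local state of $i$ is the list of the non-null actions of $i$ (reads with the value returned, but without the distinction between $\mathtt{RfB}$ and $\mathtt{RfM}$) and of the invocations at $i$ so far. A protocol $P$ assigns to every process $i$ and local state $\ell$ a nonempty set $P_i(\ell)$ of actions of $i$; $r$ is a run of $P$ if every non-null action of a process $i$ at a time $t$ is in $P_i(r_i(t))$. Runs $r,r'$ are locally equivalent, $r\approx r'$,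 if every process has the same set of local states in $r$ and in $r'$. A node is a pair $\langle b,t\rangle$ of an agent and a time. The $k$-th write of $i$ has the tag $\langle i,k\rangle$, and so has every $\mathtt{prop}$, $\mathtt{RfB}$ or $\mathtt{RfM}$ event that propagates or reads the item created by that write. The relation *occurs before* on the nodes of $r$ is the smallest transitive relation such that for all $t<t'$: 1. $\langle b,t\rangle$ occurs before $\langle b,t'\rangle$, for every agent $b$; 2. $\langle i,t\rangle$ occurs before $\langle d_i,t'\rangle$ if the former is a $\mathtt W$ or $\mathtt{RfB}$, the latter is a $\mathtt{prop}$, and they have the same tag; 3. $\langle b,t\rangle$ occurs before $\langle c,t'\rangle$ if both are memory accesses of the same variable, except if both are $\mathtt{RfM}$, or if $b=d_i$, $c=i$, the former is a $\mathtt{prop}$ and the latter an $\mathtt{RfM}$; 4. $\langle d_i,t\rangle$ occurs before $\langle i,t'\rangle$ if the former is a $\mathtt{prop}$ and the latter an $\mathtt F$ or $\mathtt{RMW}$. For a set $S$ of nodes, $\mathrm{Past}_r(S)$ is the set of nodes that occur before some node of $S$, and $\mathrm{Past}^+_r(S)=\mathrm{Past}_r(S)\cup S$. *Theorem.* Let $r$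 be a TSO run of a protocol $P$, let $S$ be a finite set of nodes, and let $\Delta\ge 0$ be an integer. Then there is a TSO run $r'\approx r$ of $P$ with $r'(0)=r(0)$ such that: (a) Every agent $b$ performs exactly the same actions (with the same tags) in the same order in both runs; the action that $b$ performs at time $t$ in $r$ is performed in $r'$ at time $t$ if $\langle b,t\rangle\in\mathrm{Past}_r(S)$, and at time $t+\Delta$ otherwise. Here an $\mathtt{RfM}$ in $r$ and an $\mathtt{RfB}$ in $r'$ with the same tag count as the same read action. (b) For every process $j$ and time $t$: $r_j(t)=r'_j(t)$ if $\langle j,t\rangle\in\mathrm{Past}^+_r(S)$, and $r_j(t)=r'_j(t+\Delta)$ otherwise. -/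

import Mathlib

namespace TSO

/-- The agents: the `n` processes and their local dispatchers. -/
inductive Agent (n : ℕ) : Type
  | proc (i : Fin n)
  | disp (i : Fin n)
  deriving DecidableEq

/-- A node: a point `⟨b, t⟩` on the timeline of the agent `b`. -/
abbrev Node (n : ℕ) : Type := Agent n × ℕ

/-- A tag `⟨i, k⟩` names the item created by the `k`-th write of process `i` (`k = 1, 2, …`). -/
abbrev Tag (n : ℕ) : Type := Fin n × ℕ

/-- Actions of agents. `prop` is the only non-null action of dispatchers, all the others are
actions of processes. `intl` are the internal actions, recorded in the local state only. -/
inductive Action (Var Val Intl : Type*)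
  | read (x : Var)
  | write (x : Var) (v : Val)
  | fence
  | rmw (x : Var) (vexp vnew : Val)
  | intl (a : Intl)
  | prop
  | null

/-- Events: actions taking place, with the values involved. A read is either a read from the
store buffer (`rfb`) or a read from memory (`rfm`). -/
inductive Event (Var Val Intl : Type*)
  | rfb (x : Var) (v : Val)
  | rfm (x : Var) (v : Val)
  | write (x : Var) (v : Val)
  | fence
  | rmw (x : Var) (vexp vnew : Val)
  | intl (a : Intl)
  | prop (x : Var) (v : Val)
  | null

/-- Entries of the local state of a process. -/
inductive Entry (Var Val Intl Op : Type*)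
  | read (x : Var) (v : Val)
  | write (x : Var) (v : Val)
  | fence
  | rmw (x : Var) (vexp vnew : Val)
  | intl (a : Intl)
  | invoke (o : Op)

/-- A local state is the list of the observations of a process so far. -/
abbrev LocalState (Var Val Intl Op : Type*) : Type _ := List (Entry Var Val Intl Op)

/-- A basic TSO state: the main memory and a store buffer for every process
(oldest item first). -/
@[ext]
structure MemState (n : ℕ) (Var Val : Type*) where
  mem : Var → Val
  buf : Fin n → List (Var × Val)

/-- A global state: a basic TSO state and a local state for every process. -/
@[ext]
structure GlobalState (n : ℕ) (Var Val Intl Op : Type*) where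
  tso : MemState n Var Val
  loc : Fin n → LocalState Var Val Intl Op

/-- A joint action: an action for every agent and at most one invocation for every process. -/
structure JointAction (n : ℕ) (Var Val Intl Op : Type*) where
  act : Agent n → Action Var Val Intl
  invoke : Fin n → Option Op

namespace MemState

variable {n : ℕ} {Var Val Intl Op : Type*}

/-- The precondition of an action of an agent in a TSO state. -/
def Enabled (σ : MemState n Var Val) : Agent n → Action Var Val Intl → Prop
  | .proc _, .read _ => True
  | .proc _, .write _ _ => True
  | .proc i, .fence => σ.buf i = []
  | .proc i, .rmw x vexp _ => σ.buf i = [] ∧ σ.mem x = vexp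
  | .proc _, .intl _ => True
  | .proc _, .null => True
  | .proc _, .prop => False
  | .disp i, .prop => σ.buf i ≠ []
  | .disp _, .null => True
  | .disp _, _ => False

variable [DecidableEq Var]

/-- The value of the latest item for `x` in the buffer of `i`, if there is one. -/
def bufValue (σ : MemState n Var Val) (i : Fin n) (x : Var) : Option Val :=
  (((σ.buf i).filter (fun p => p.1 = x)).getLast?).map Prod.snd

/-- The event that results when an agent performs an action in a TSO state. -/
def event (σ : MemState n Var Val) : Agent n → Action Var Val Intl → Event Var Val Intl
  | .proc i, .read x =>
      match σ.bufValue i x with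
      | some v => .rfb x v
      | none => .rfm x (σ.mem x)
  | .proc _, .write x v => .write x v
  | .proc _, .fence => .fence
  | .proc _, .rmw x vexp vnew => .rmw x vexp vnew
  | .proc _, .intl a => .intl a
  | .disp i, .prop =>
      match σ.buf i with
      | (x, v) :: _ => .prop x v
      | [] => .null
  | _, _ => .null

/-- The TSO state that results when an agent performs an action in a TSO state. -/
def perform (σ : MemState n Var Val) : Agent n → Action Var Val Intl → MemState n Var Val
  | .proc i, .write x v => ⟨σ.mem, Function.update σ.buf i (σ.buf i ++ [(x, v)])⟩
  | .proc _, .rmw x _ vnew => ⟨Function.update σ.mem x vnew, σ.buf⟩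
  | .disp i, .prop =>
      match σ.buf i with
      | (x, v) :: β => ⟨Function.update σ.mem x v, Function.update σ.buf i β⟩
      | [] => σ
  | _, _ => σ

/-- Perform the actions of the listed agents one by one. -/
def performList (σ : MemState n Var Val) (a : Agent n → Action Var Val Intl)
    (l : List (Agent n)) : MemState n Var Val :=
  l.foldl (fun τ b => τ.perform b (a b)) σ

end MemState

/-- The order in which the actions of a joint action take effect within a round: the dispatchers
`d_1, …, d_n`, then the processes `1, …, n`. (The invocations, which do not touch the TSO state,
come last.) -/
def agentOrder (n : ℕ) : List (Agent n) :=
  (List.finRange n).map Agent.disp ++ (List.finRange n).map Agent.proc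

namespace MemState

variable {n : ℕ} {Var Val Intl Op : Type*} [DecidableEq Var]

/-- The TSO state after a whole joint action. -/
def next (σ : MemState n Var Val) (a : Agent n → Action Var Val Intl) : MemState n Var Val :=
  σ.performList a (agentOrder n)

/-- The TSO state in which the action of `b` takes effect, within a joint action. -/
def before (σ : MemState n Var Val) (a : Agent n → Action Var Val Intl) (b : Agent n) :
    MemState n Var Val :=
  σ.performList a ((agentOrder n).takeWhile (fun c => c ≠ b))

/-- The event at the agent `b` when a joint action takes place. -/
def jointEvent (σ : MemState n Var Val) (a : Agent n → Action Var Val Intl) (b : Agent n) :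
    Event Var Val Intl :=
  (σ.before a b).event b (a b)

end MemState

namespace Event

variable {Var Val Intl : Type*}

/-- What a process records of an event in its local state. It does not observe whether a read is
from its buffer or from memory, and null actions leave no record. -/
def entries (Op : Type*) : Event Var Val Intl → List (Entry Var Val Intl Op)
  | .rfb x v => [.read x v]
  | .rfm x v => [.read x v]
  | .write x v => [.write x v]
  | .fence => [.fence]
  | .rmw x vexp vnew => [.rmw x vexp vnew]
  | .intl a => [.intl a]
  | .prop _ _ => []
  | .null => []

def IsRfM (e : Event Var Val Intl) : Prop := ∃ x v, e = .rfm x v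
def IsRfB (e : Event Var Val Intl) : Prop := ∃ x v, e = .rfb x v
def IsWrite (e : Event Var Val Intl) : Prop := ∃ x v, e = .write x v
def IsProp (e : Event Var Val Intl) : Prop := ∃ x v, e = .prop x v
def IsRMW (e : Event Var Val Intl) : Prop := ∃ x v w, e = .rmw x v w

/-- Events that change the variable `x` in memory. -/
def ChangesMem (e : Event Var Val Intl) (x : Var) : Prop :=
  (∃ v w, e = .rmw x v w) ∨ (∃ v, e = .prop x v)

/-- Memory accesses of the variable `x`. -/
def Accesses (e : Event Var Val Intl) (x : Var) : Prop :=
  (∃ v w, e = .rmw x v w) ∨ (∃ v, e = .prop x v) ∨ (∃ v, e = .rfm x v)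

end Event

/-- `b` is the dispatcher of the process `c`, `b` propagates, and `c` reads from memory. -/
def PropRfM {n : ℕ} {Var Val Intl : Type*} (b : Agent n) (e : Event Var Val Intl)
    (c : Agent n) (f : Event Var Val Intl) : Prop :=
  ∃ i, b = .disp i ∧ c = .proc i ∧ e.IsProp ∧ f.IsRfM

/-- The events `e` at `b` and `f` at `c` are conflicting. -/
def Conflicting {n : ℕ} {Var Val Intl : Type*} (b : Agent n) (e : Event Var Val Intl)
    (c : Agent n) (f : Event Var Val Intl) : Prop :=
  ¬ (e.IsRfM ∧ f.IsRfM) ∧ (∃ x, e.Accesses x ∧ f.Accesses x) ∧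
    ¬ (PropRfM b e c f ∨ PropRfM c f b e)

/-- A TSO run, with time `ℕ`: the global state at every time `t`, and the joint action that takes
place at time `t` (in round `t + 1`) and leads from the state at `t` to the state at `t + 1`.
The memory is arbitrary initially. -/
structure Run (n : ℕ) (Var Val Intl Op : Type*) [DecidableEq Var] where
  state : ℕ → GlobalState n Var Val Intl Op
  joint : ℕ → JointAction n Var Val Intl Op
  buf_zero : ∀ i, (state 0).tso.buf i = []
  loc_zero : ∀ i, (state 0).loc i = []
  enabled : ∀ t b, (state t).tso.Enabled b ((joint t).act b)
  nonconflicting : ∀ t b c, b ≠ c →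
    ¬ Conflicting b ((state t).tso.jointEvent (joint t).act b)
      c ((state t).tso.jointEvent (joint t).act c)
  tso_succ : ∀ t, (state (t + 1)).tso = (state t).tso.next (joint t).act
  loc_succ : ∀ t i, (state (t + 1)).loc i =
    (state t).loc i
      ++ ((state t).tso.jointEvent (joint t).act (.proc i)).entries Op
      ++ (((joint t).invoke i).map Entry.invoke).toList

/-- A (nondeterministic) protocol assigns to every local state of every process a nonempty set of
process actions. -/
structure Protocol (n : ℕ) (Var Val Intl Op : Type*) where
  acts : Fin n → LocalState Var Val Intl Op → Set (Action Var Val Intl)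
  nonempty : ∀ i ℓ, (acts i ℓ).Nonempty
  not_prop : ∀ i ℓ, Action.prop ∉ acts i ℓ

namespace Run

variable {n : ℕ} {Var Val Intl Op : Type*} [DecidableEq Var]

/-- The action of the agent `b` at time `t`. -/
def action (r : Run n Var Val Intl Op) (b : Agent n) (t : ℕ) : Action Var Val Intl :=
  (r.joint t).act b

/-- The event at the node `⟨b, t⟩`. -/
def event (r : Run n Var Val Intl Op) (b : Agent n) (t : ℕ) : Event Var Val Intl :=
  (r.state t).tso.jointEvent (r.joint t).act b

/-- The local state of the process `i` at time `t`. -/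
def loc (r : Run n Var Val Intl Op) (i : Fin n) (t : ℕ) : LocalState Var Val Intl Op :=
  (r.state t).loc i

/-- `r` is a run of the protocol `P`. -/
def IsRunOf (r : Run n Var Val Intl Op) (P : Protocol n Var Val Intl Op) : Prop :=
  ∀ t i, r.action (.proc i) t ≠ .null → r.action (.proc i) t ∈ P.acts i (r.loc i t)

/-- The number of writes of `i` at times `≤ t`. -/
noncomputable def writeCount (r : Run n Var Val Intl Op) (i : Fin n) (t : ℕ) : ℕ :=
  {s | s ≤ t ∧ (r.event (.proc i) s).IsWrite}.ncard

/-- The number of propagations by `d_i` at times `≤ t`. -/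
noncomputable def propCount (r : Run n Var Val Intl Op) (i : Fin n) (t : ℕ) : ℕ :=
  {s | s ≤ t ∧ (r.event (.disp i) s).IsProp}.ncard

/-- `r.HasTag b t κ`: the event at `⟨b, t⟩` has the tag `κ`, i.e. it writes, propagates or reads
the item named by `κ`. Buffers are first-in-first-out queues, so the `k`-th propagation by `d_i`
propagates the item of the `k`-th write of `i`; a read of `x` from the buffer reads the item of the
latest write to `x` by the process; a read of `x` from memory reads the item propagated last to
`x`, unless `x` has been changed by a read-modify-write since. Values of `x` that stem from
the initial memory or from a read-modify-write have no tag. Within a round propagations precede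
reads, so the propagation may be in the same round as the read from memory. -/
inductive HasTag (r : Run n Var Val Intl Op) : Agent n → ℕ → Tag n → Prop
  | write (i : Fin n) (t : ℕ) (h : (r.event (.proc i) t).IsWrite) :
      HasTag r (.proc i) t (i, r.writeCount i t)
  | prop (i : Fin n) (t : ℕ) (h : (r.event (.disp i) t).IsProp) :
      HasTag r (.disp i) t (i, r.propCount i t)
  | rfb (i : Fin n) (s t : ℕ) (x : Var) (v w : Val) (h : r.event (.proc i) t = .rfb x v)
      (hst : s < t) (hs : r.event (.proc i) s = .write x w)
      (hlast : ∀ u, s < u → u < t → ∀ w', r.event (.proc i) u ≠ .write x w') :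
      HasTag r (.proc i) t (i, r.writeCount i s)
  | rfm (i j : Fin n) (s t : ℕ) (x : Var) (v w : Val) (h : r.event (.proc i) t = .rfm x v)
      (hst : s ≤ t) (hs : r.event (.disp j) s = .prop x w)
      (hlast : ∀ u, s < u → u ≤ t → ∀ c, ¬ (r.event c u).ChangesMem x) :
      HasTag r (.proc i) t (j, r.propCount j s)

/-- The occurs-before relation between the nodes of a run. -/
inductive OccursBefore (r : Run n Var Val Intl Op) : Node n → Node n → Prop
  | locality (b : Agent n) (t t' : ℕ) (ht : t < t') : OccursBefore r (b, t) (b, t')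
  | buffer (i : Fin n) (t t' : ℕ) (ht : t < t') (κ : Tag n)
      (h : (r.event (.proc i) t).IsWrite ∨ (r.event (.proc i) t).IsRfB)
      (h' : (r.event (.disp i) t').IsProp)
      (hκ : r.HasTag (.proc i) t κ) (hκ' : r.HasTag (.disp i) t' κ) :
      OccursBefore r (.proc i, t) (.disp i, t')
  | access (b c : Agent n) (t t' : ℕ) (ht : t < t') (x : Var)
      (h : (r.event b t).Accesses x) (h' : (r.event c t').Accesses x)
      (hR : ¬ ((r.event b t).IsRfM ∧ (r.event c t').IsRfM))
      (hP : ¬ PropRfM b (r.event b t) c (r.event c t')) :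
      OccursBefore r (b, t) (c, t')
  | fence (i : Fin n) (t t' : ℕ) (ht : t < t') (h : (r.event (.disp i) t).IsProp)
      (h' : r.event (.proc i) t' = .fence ∨ (r.event (.proc i) t').IsRMW) :
      OccursBefore r (.disp i, t) (.proc i, t')
  | trans (θ θ' θ'' : Node n) (h : OccursBefore r θ θ') (h' : OccursBefore r θ' θ'') :
      OccursBefore r θ θ''

/-- The past of a set of nodes. -/
def Past (r : Run n Var Val Intl Op) (S : Set (Node n)) : Set (Node n) :=
  {θ | ∃ θ' ∈ S, r.OccursBefore θ θ'}

def PastPlus (r : Run n Var Val Intl Op) (S : Set (Node n)) : Set (Node n) :=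
  r.Past S ∪ S

/-- Local equivalence: every process passes through the same local states in both runs. -/
def LocallyEquivalent (r r' : Run n Var Val Intl Op) : Prop :=
  ∀ j ℓ, (∃ t, r.loc j t = ℓ) ↔ (∃ t, r'.loc j t = ℓ)

open Classical in
/-- The time to which an action of `b` at time `t` is moved: it is kept if `⟨b, t⟩` is in the past
of `S`, and delayed by `Δ` otherwise. -/
noncomputable def newTime (r : Run n Var Val Intl Op) (S : Set (Node n)) (Δ : ℕ) (b : Agent n)
    (t : ℕ) : ℕ :=
  if (b, t) ∈ r.Past S then t else t + Δ

end Run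

end TSO

/-! The theorem is an instance of a general fact (`IsReschedule.run`): if a change `φ` of the times
is strictly increasing at every agent and strictly respects occurs-before, then performing the same
actions at the new times gives a legal run in which every process passes through the same local
states. The delay `newTime` is such a change (`newTime_lt_newTime`): the past of `S` is closed under
predecessors, so no node that is delayed occurs before one that is not, and occurs-before implies an
increase of time.

For the general fact, let `clock φ b u` count the steps that `b` takes before the new time `u`. The
buffer of `i` then consists of the items that `i` has written up to its own clock, without as many
of the oldest ones as `d_i` has propagated up to the clock of `d_i` (`reTso_buf`). The value of `x`
in memory is that of the last change of `x` moved to a time before `u`, and the changes of `x` are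
linearly ordered by occurs-before, hence keep their order (`lastValue_reTso_mem`). Clause 2 ensures
that items are written before they are propagated, clause 3 that no conflicts arise and that an RMW
finds the expected value, clause 4 that buffers are empty at fences and RMWs.

The delicate case is a memory read of `x` by `i`, since an earlier propagation by `d_i` need not
occur before it and may be moved past it. If `i` then finds an item for `x` in its buffer, that item
had been propagated in the given run, and no change of `x` can lie between this propagation and the
read: one by `d_i` would stem from a later item, and one by another agent would link the propagation
to the read in occurs-before. So the read returns the same item, now from the buffer
(`rfm_of_lookup`). If `i` finds none, the changes of `x` up to the read are the same as before
(`changesMem_le_iff_of_lookup`). A read from the buffer stays one by clause 2 (`reEvent_of_rfb`). -/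

namespace TSO

/-! ### Buffers as lists of items, and the last item for a variable -/

namespace Action

variable {Var Val Intl : Type*}

/-- The items that an action of a process appends to its buffer. -/
def items : Action Var Val Intl → List (Var × Val)
  | .write x v => [(x, v)]
  | _ => []

/-- The number of items that an action of a dispatcher removes from the buffer. -/
def pops : Action Var Val Intl → ℕ
  | .prop => 1
  | _ => 0

end Action

section Lookup

variable {Var Val : Type*} [DecidableEq Var]

/-- The value of the last item for `x` in a list of items. -/
def lookup (l : List (Var × Val)) (x : Var) : Option Val :=
  ((l.filter (fun p => p.1 = x)).getLast?).map Prod.snd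

theorem lookup_append_singleton (l : List (Var × Val)) (p : Var × Val) (x : Var) :
    lookup (l ++ [p]) x = if p.1 = x then some p.2 else lookup l x := by
  unfold lookup
  split_ifs with h <;> simp [List.filter_append, h]

theorem lookup_eq_none_iff (l : List (Var × Val)) (x : Var) :
    lookup l x = none ↔ ∀ (k : ℕ) (w : Val), l[k]? ≠ some (x, w) := by
  unfold lookup
  simp only [Option.map_eq_none_iff, List.getLast?_eq_none_iff, List.filter_eq_nil_iff,
    decide_eq_true_eq]
  constructor
  · intro h k w hk
    exact h _ (List.mem_of_getElem? hk) rfl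
  · rintro h ⟨y, w⟩ hp rfl
    obtain ⟨k, hk⟩ := List.mem_iff_getElem?.1 hp
    exact h k w hk

theorem lookup_eq_some_iff (l : List (Var × Val)) (x : Var) (v : Val) :
    lookup l x = some v ↔
      ∃ k : ℕ, l[k]? = some (x, v) ∧ ∀ k', k < k' → ∀ w, l[k']? ≠ some (x, w) := by
  induction l using List.reverseRecOn with
  | nil => simp [lookup]
  | append_singleton l p ih =>
    rw [lookup_append_singleton]
    split_ifs with h
    · constructor
      · intro hv
        refine ⟨l.length, ?_, ?_⟩
        · obtain ⟨y, w⟩ := p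
          simp_all
        · intro k' hk' w
          rw [List.getElem?_eq_none (by simp; omega)]
          simp
      · rintro ⟨k, hk, hlast⟩
        have hkl : k = l.length := by
          have h1 : k < (l ++ [p]).length := (List.getElem?_eq_some_iff.1 hk).1
          by_contra hne
          simp only [List.length_append, List.length_singleton] at h1
          refine hlast l.length (by omega) p.2 ?_
          subst h
          simp
        subst hkl
        simp_all
    · rw [ih]
      constructor
      · rintro ⟨k, hk, hlast⟩
        have h1 : k < l.length := (List.getElem?_eq_some_iff.1 hk).1
        refine ⟨k, by rwa [List.getElem?_append_left h1], fun k' hk' w hw => ?_⟩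
        rcases lt_or_ge k' l.length with h2 | h2
        · rw [List.getElem?_append_left h2] at hw
          exact hlast k' hk' w hw
        · have h3 : k' < (l ++ [p]).length := (List.getElem?_eq_some_iff.1 hw).1
          simp only [List.length_append, List.length_singleton] at h3
          obtain rfl : k' = l.length := by omega
          simp at hw
          exact h (by rw [hw])
      · rintro ⟨k, hk, hlast⟩
        have h1 : k < (l ++ [p]).length := (List.getElem?_eq_some_iff.1 hk).1
        simp only [List.length_append, List.length_singleton] at h1
        rcases Nat.lt_succ_iff_lt_or_eq.1 h1 with h2 | rfl
        · rw [List.getElem?_append_left h2] at hk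
          refine ⟨k, hk, fun k' hk' w hw => hlast k' hk' w ?_⟩
          rwa [List.getElem?_append_left (List.getElem?_eq_some_iff.1 hw).1]
        · simp at hk
          exact absurd (by rw [hk]) h

theorem lookup_drop_eq_none_iff (l : List (Var × Val)) (p : ℕ) (x : Var) :
    lookup (l.drop p) x = none ↔ ∀ k w, p ≤ k → l[k]? ≠ some (x, w) := by
  rw [lookup_eq_none_iff]
  simp only [List.getElem?_drop]
  constructor
  · intro h k w hk
    obtain ⟨m, rfl⟩ := Nat.exists_eq_add_of_le hk
    exact h m w
  · exact fun h k w => h (p + k) w (by omega)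

/-- The index `k` is a position in the full list, so `p` matters only through `p ≤ k`. This makes it
possible to compare reads that see the same written items but different numbers of propagations. -/
theorem lookup_drop_eq_some_iff (l : List (Var × Val)) (p : ℕ) (x : Var) (v : Val) :
    lookup (l.drop p) x = some v ↔
      ∃ k, p ≤ k ∧ l[k]? = some (x, v) ∧ ∀ k', k < k' → ∀ w, l[k']? ≠ some (x, w) := by
  rw [lookup_eq_some_iff]
  simp only [List.getElem?_drop]
  constructor
  · rintro ⟨k, hk, h⟩
    refine ⟨p + k, by omega, hk, fun k' hk' w => ?_⟩
    obtain ⟨m, rfl⟩ := Nat.exists_eq_add_of_le (show p ≤ k' by omega)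
    exact h m (by omega) w
  · rintro ⟨k, hpk, hk, h⟩
    obtain ⟨m, rfl⟩ := Nat.exists_eq_add_of_le hpk
    exact ⟨m, hk, fun k' hk' w => h (p + k') (by omega) w⟩

end Lookup

/-! ### The order of the agents within a round -/

theorem takeWhile_ne_append_cons {α : Type*} [DecidableEq α] (l₁ l₂ : List α) (b : α)
    (h : b ∉ l₁) : (l₁ ++ b :: l₂).takeWhile (fun c => c ≠ b) = l₁ := by
  induction l₁ with
  | nil => simp
  | cons a l ih =>
    rw [List.mem_cons, not_or] at h
    have := ih h.2
    simp_all [Ne.symm h.1]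

theorem nodup_agentOrder (n : ℕ) : (agentOrder n).Nodup := by
  unfold agentOrder
  refine List.Nodup.append ?_ ?_ ?_
  · exact (List.nodup_finRange n).map (fun _ _ h => by simpa using h)
  · exact (List.nodup_finRange n).map (fun _ _ h => by simpa using h)
  · intro b
    simp only [List.mem_map]
    rintro ⟨i, -, rfl⟩ ⟨j, -, h⟩
    cases h

theorem mem_agentOrder {n : ℕ} (b : Agent n) : b ∈ agentOrder n := by
  cases b <;> simp [agentOrder]

/-- The order of the agents, split at a dispatcher and at its process. -/
theorem agentOrder_split {n : ℕ} (i : Fin n) :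
    ∃ l₁ l₂ l₃ : List (Agent n),
      agentOrder n = l₁ ++ Agent.disp i :: (l₂ ++ Agent.proc i :: l₃) ∧
      (Agent.disp i ∉ l₁ ∧ Agent.proc i ∉ l₁) ∧ (Agent.disp i ∉ l₂ ∧ Agent.proc i ∉ l₂) ∧
      (Agent.disp i ∉ l₃ ∧ Agent.proc i ∉ l₃) ∧ ∀ b ∈ l₃, ∃ j, b = Agent.proc j := by
  obtain ⟨s, t, hst⟩ := List.append_of_mem (List.mem_finRange i)
  have hnd := List.nodup_finRange n
  rw [hst, List.nodup_append] at hnd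
  have hs : i ∉ s := fun h => hnd.2.2 i h i (by simp) rfl
  have ht : i ∉ t := (List.nodup_cons.1 hnd.2.1).1
  refine ⟨s.map .disp, t.map .disp ++ s.map .proc, t.map .proc, ?_, ?_, ?_, ?_, ?_⟩
  · simp [agentOrder, hst]
  · simp [hs]
  · simp [hs, ht]
  · simp [ht]
  · intro b hb
    obtain ⟨j, -, rfl⟩ := List.mem_map.1 hb
    exact ⟨j, rfl⟩

/-! ### Events that change memory -/

namespace Event

variable {Var Val Intl : Type*}

/-- The event sets the variable `x` in memory to `v`. -/
def Sets (e : Event Var Val Intl) (x : Var) (v : Val) : Prop :=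
  (∃ w, e = .rmw x w v) ∨ e = .prop x v

theorem changesMem_iff {e : Event Var Val Intl} {x : Var} : e.ChangesMem x ↔ ∃ v, e.Sets x v := by
  constructor
  · rintro (⟨w, v, h⟩ | ⟨v, h⟩)
    · exact ⟨v, .inl ⟨w, h⟩⟩
    · exact ⟨v, .inr h⟩
  · rintro ⟨v, ⟨w, h⟩ | h⟩
    · exact .inl ⟨w, v, h⟩
    · exact .inr ⟨v, h⟩

theorem Sets.changesMem {e : Event Var Val Intl} {x : Var} {v : Val} (h : e.Sets x v) :
    e.ChangesMem x :=
  changesMem_iff.2 ⟨v, h⟩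

theorem Sets.unique {e : Event Var Val Intl} {x : Var} {v w : Val} (h : e.Sets x v)
    (h' : e.Sets x w) : v = w := by
  rcases h with ⟨_, rfl⟩ | rfl <;> rcases h' with ⟨_, h'⟩ | h' <;> cases h' <;> rfl

theorem ChangesMem.accesses {e : Event Var Val Intl} {x : Var} (h : e.ChangesMem x) :
    e.Accesses x :=
  h.elim .inl fun h => .inr (.inl h)

theorem ChangesMem.not_isRfM {e : Event Var Val Intl} {x : Var} (h : e.ChangesMem x) :
    ¬ e.IsRfM := by
  rintro ⟨y, w, rfl⟩
  rcases h with ⟨_, _, h⟩ | ⟨_, h⟩ <;> cases h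

end Event

/-! ### The effect of one round on buffers, memory and events -/

namespace MemState

variable {n : ℕ} {Var Val Intl : Type*} [DecidableEq Var]

theorem perform_buf_disp (σ : MemState n Var Val) (i : Fin n) (α : Action Var Val Intl) :
    (σ.perform (.disp i) α).buf i = (σ.buf i).drop α.pops := by
  cases α <;> simp only [perform, Action.pops, List.drop_zero]
  cases h : σ.buf i <;> simp [h]

theorem perform_buf_proc (σ : MemState n Var Val) (i : Fin n) (α : Action Var Val Intl) :
    (σ.perform (.proc i) α).buf i = σ.buf i ++ α.items := by
  cases α <;> simp [perform, Action.items]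

theorem perform_buf_of_ne (σ : MemState n Var Val) (i : Fin n) (b : Agent n)
    (α : Action Var Val Intl) (hd : b ≠ .disp i) (hp : b ≠ .proc i) :
    (σ.perform b α).buf i = σ.buf i := by
  rcases b with j | j <;> cases α <;> simp only [perform]
  · have : i ≠ j := by rintro rfl; exact hp rfl
    simp [this]
  · have : i ≠ j := by rintro rfl; exact hd rfl
    cases h : σ.buf j <;> simp [this]

theorem performList_append (σ : MemState n Var Val) (a : Agent n → Action Var Val Intl)
    (l₁ l₂ : List (Agent n)) :
    σ.performList a (l₁ ++ l₂) = (σ.performList a l₁).performList a l₂ := by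
  simp [performList]

theorem performList_cons (σ : MemState n Var Val) (a : Agent n → Action Var Val Intl)
    (b : Agent n) (l : List (Agent n)) :
    σ.performList a (b :: l) = (σ.perform b (a b)).performList a l := rfl

theorem performList_buf_of_notMem (σ : MemState n Var Val) (a : Agent n → Action Var Val Intl)
    (i : Fin n) (l : List (Agent n)) (h : Agent.disp i ∉ l ∧ Agent.proc i ∉ l) :
    (σ.performList a l).buf i = σ.buf i := by
  induction l generalizing σ with
  | nil => rfl
  | cons b l ih =>
    simp only [List.mem_cons, not_or] at h
    rw [performList_cons, ih _ ⟨h.1.2, h.2.2⟩,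
      perform_buf_of_ne _ _ _ _ (Ne.symm h.1.1) (Ne.symm h.2.1)]

theorem before_eq (σ : MemState n Var Val) (a : Agent n → Action Var Val Intl) (b : Agent n)
    {l₁ l₂ : List (Agent n)} (h : agentOrder n = l₁ ++ b :: l₂) :
    σ.before a b = σ.performList a l₁ := by
  have hb : b ∉ l₁ := by
    have hnd := nodup_agentOrder n
    rw [h, List.nodup_append] at hnd
    exact fun hm => hnd.2.2 b hm b (by simp) rfl
  rw [before, h, takeWhile_ne_append_cons _ _ _ hb]

theorem before_disp_buf (σ : MemState n Var Val) (a : Agent n → Action Var Val Intl)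
    (i : Fin n) : (σ.before a (.disp i)).buf i = σ.buf i := by
  obtain ⟨l₁, l₂, l₃, h, h₁, -⟩ := agentOrder_split i
  rw [before_eq σ a _ h, performList_buf_of_notMem _ _ _ _ h₁]

theorem before_proc_buf (σ : MemState n Var Val) (a : Agent n → Action Var Val Intl)
    (i : Fin n) :
    (σ.before a (.proc i)).buf i = (σ.buf i).drop (a (.disp i)).pops := by
  obtain ⟨l₁, l₂, l₃, h, h₁, h₂, -⟩ := agentOrder_split i
  rw [before_eq σ a (.proc i) (l₁ := l₁ ++ .disp i :: l₂) (l₂ := l₃) (by simp [h]),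
    performList_append, performList_cons, performList_buf_of_notMem _ _ _ _ h₂,
    perform_buf_disp, performList_buf_of_notMem _ _ _ _ h₁]

theorem next_buf (σ : MemState n Var Val) (a : Agent n → Action Var Val Intl) (i : Fin n) :
    (σ.next a).buf i = (σ.buf i).drop (a (.disp i)).pops ++ (a (.proc i)).items := by
  obtain ⟨l₁, l₂, l₃, h, h₁, h₂, h₃, -⟩ := agentOrder_split i
  rw [next, h, performList_append, performList_cons, performList_append, performList_cons,
    performList_buf_of_notMem _ _ _ _ h₃, perform_buf_proc, performList_buf_of_notMem _ _ _ _ h₂,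
    perform_buf_disp, performList_buf_of_notMem _ _ _ _ h₁]

theorem perform_mem_of_not_changesMem (σ : MemState n Var Val) (b : Agent n)
    (α : Action Var Val Intl) (x : Var) (h : ¬ (σ.event b α).ChangesMem x) :
    (σ.perform b α).mem x = σ.mem x := by
  rcases b with i | i <;> cases α <;> simp only [perform]
  · rename_i y v w
    refine Function.update_of_ne ?_ _ _
    rintro rfl
    exact h (.inl ⟨_, _, rfl⟩)
  · cases hb : σ.buf i with
    | nil => rfl
    | cons p β =>
      refine Function.update_of_ne ?_ _ _
      rintro rfl
      exact h (.inr ⟨p.2, by simp [event, hb]⟩)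

theorem perform_mem_of_sets (σ : MemState n Var Val) (b : Agent n)
    (α : Action Var Val Intl) (x : Var) (v : Val) (h : (σ.event b α).Sets x v) :
    (σ.perform b α).mem x = v := by
  rcases b with i | i <;> cases α
  case proc.read y =>
    simp only [event] at h
    split at h <;> rcases h with ⟨_, h⟩ | h <;> cases h
  case proc.rmw y w w' =>
    rcases h with ⟨_, h⟩ | h <;> cases h
    simp [perform]
  case disp.prop =>
    cases hb : σ.buf i with
    | nil =>
      simp only [event, hb] at h
      rcases h with ⟨_, h⟩ | h <;> cases h
    | cons p β =>
      simp only [event, hb] at h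
      rcases h with ⟨_, h⟩ | h <;> cases h
      simp [perform, hb]
  all_goals rcases h with ⟨_, h⟩ | h <;> cases h

/-- The prefix `l₁` is needed because the event at an agent depends on the agents that act before
it; the induction moves the agents of `l₂` one by one into the prefix. -/
theorem performList_mem_append (σ : MemState n Var Val) (a : Agent n → Action Var Val Intl)
    (x : Var) (l₁ l₂ l₃ : List (Agent n)) (h : agentOrder n = l₁ ++ (l₂ ++ l₃))
    (hx : ∀ b ∈ l₂, ¬ (σ.jointEvent a b).ChangesMem x) :
    (σ.performList a (l₁ ++ l₂)).mem x = (σ.performList a l₁).mem x := by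
  induction l₂ generalizing l₁ with
  | nil => simp
  | cons b l ih =>
    have h' : agentOrder n = (l₁ ++ [b]) ++ (l ++ l₃) := by simpa using h
    have := ih (l₁ ++ [b]) h' (fun c hc => hx c (List.mem_cons_of_mem _ hc))
    rw [List.append_assoc, List.singleton_append] at this
    rw [this, performList_append]
    have hb := hx b (by simp)
    rw [jointEvent, before_eq σ a b h] at hb
    exact perform_mem_of_not_changesMem _ _ _ _ hb

theorem next_mem_of_not_changesMem (σ : MemState n Var Val) (a : Agent n → Action Var Val Intl)
    (x : Var) (h : ∀ b, ¬ (σ.jointEvent a b).ChangesMem x) : (σ.next a).mem x = σ.mem x :=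
  performList_mem_append σ a x [] (agentOrder n) [] (by simp) (fun b _ => h b)

theorem next_mem_of_sets (σ : MemState n Var Val) (a : Agent n → Action Var Val Intl)
    (x : Var) (v : Val) (b : Agent n) (hb : (σ.jointEvent a b).Sets x v)
    (h : ∀ c, c ≠ b → ¬ (σ.jointEvent a c).ChangesMem x) : (σ.next a).mem x = v := by
  obtain ⟨l₁, l₂, hl⟩ := List.append_of_mem (mem_agentOrder b)
  have hnd := nodup_agentOrder n
  rw [hl, List.nodup_append] at hnd
  have hb₂ : b ∉ l₂ := (List.nodup_cons.1 hnd.2.1).1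
  have hl' : agentOrder n = (l₁ ++ [b]) ++ (l₂ ++ []) := by simpa using hl
  have key := performList_mem_append σ a x (l₁ ++ [b]) l₂ [] hl'
    (fun c hc => h c (by rintro rfl; exact hb₂ hc))
  rw [next, hl', List.append_nil, key, performList_append]
  rw [jointEvent, before_eq σ a b hl] at hb
  exact perform_mem_of_sets _ _ _ _ _ hb

/-- When a process acts, all dispatchers have acted already, so only processes could still change
`x` in this round. -/
theorem before_proc_mem (σ : MemState n Var Val) (a : Agent n → Action Var Val Intl)
    (x : Var) (i : Fin n) (h : ∀ j, ¬ (σ.jointEvent a (.proc j)).ChangesMem x) :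
    (σ.before a (.proc i)).mem x = (σ.next a).mem x := by
  obtain ⟨l₁, l₂, l₃, hl, -, -, -, h₃⟩ := agentOrder_split i
  have hl' : agentOrder n = (l₁ ++ .disp i :: l₂) ++ (.proc i :: l₃) := by simp [hl]
  rw [before_eq σ a (.proc i) hl', next, hl']
  refine (performList_mem_append σ a x _ (.proc i :: l₃) [] (by simp [hl]) ?_).symm
  intro b hb
  rcases List.mem_cons.1 hb with rfl | hb
  · exact h i
  · obtain ⟨j, rfl⟩ := h₃ b hb
    exact h j

theorem jointEvent_disp_eq_prop_iff (σ : MemState n Var Val)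
    (a : Agent n → Action Var Val Intl) (i : Fin n) (x : Var) (v : Val) :
    σ.jointEvent a (.disp i) = .prop x v ↔ a (.disp i) = .prop ∧ (σ.buf i)[0]? = some (x, v) := by
  rw [jointEvent]
  have hb := before_disp_buf σ a i
  cases h : a (.disp i) <;> simp only [event, hb, reduceCtorEq, false_and, true_and]
  cases h' : σ.buf i <;> simp [Prod.ext_iff]

theorem jointEvent_read (σ : MemState n Var Val) (a : Agent n → Action Var Val Intl) (i : Fin n)
    (x : Var) (h : a (.proc i) = .read x) :
    σ.jointEvent a (.proc i) =
      match lookup ((σ.buf i).drop (a (.disp i)).pops) x with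
      | some v => .rfb x v
      | none => .rfm x ((σ.before a (.proc i)).mem x) := by
  rw [← before_proc_buf, jointEvent, h]
  rfl

/-- The event of an action of a process that is not a read. -/
theorem jointEvent_proc_of_not_read (σ τ : MemState n Var Val)
    (a a' : Agent n → Action Var Val Intl) (i : Fin n) (h : a (.proc i) = a' (.proc i))
    (hr : ∀ x, a (.proc i) ≠ .read x) :
    σ.jointEvent a (.proc i) = τ.jointEvent a' (.proc i) := by
  rw [jointEvent, jointEvent, ← h]
  cases h' : a (.proc i) <;> first | rfl | exact absurd h' (hr _)

theorem jointEvent_of_null (σ : MemState n Var Val) (a : Agent n → Action Var Val Intl)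
    (b : Agent n) (h : a b = .null) : σ.jointEvent a b = .null := by
  rw [jointEvent, h]
  cases b <;> rfl

theorem jointEvent_proc_eq_write_iff (σ : MemState n Var Val)
    (a : Agent n → Action Var Val Intl) (i : Fin n) (x : Var) (v : Val) :
    σ.jointEvent a (.proc i) = .write x v ↔ a (.proc i) = .write x v := by
  rw [jointEvent]
  cases h : a (.proc i) <;> simp [event]
  split <;> simp

theorem jointEvent_proc_eq_rmw_iff (σ : MemState n Var Val)
    (a : Agent n → Action Var Val Intl) (i : Fin n) (x : Var) (v w : Val) :
    σ.jointEvent a (.proc i) = .rmw x v w ↔ a (.proc i) = .rmw x v w := by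
  rw [jointEvent]
  cases h : a (.proc i) <;> simp [event]
  split <;> simp

theorem jointEvent_proc_ne_prop (σ : MemState n Var Val)
    (a : Agent n → Action Var Val Intl) (i : Fin n) (x : Var) (v : Val) :
    σ.jointEvent a (.proc i) ≠ .prop x v := by
  rw [jointEvent]
  cases h : a (.proc i) <;> simp [event]
  split <;> simp

theorem jointEvent_disp_cases (σ : MemState n Var Val)
    (a : Agent n → Action Var Val Intl) (i : Fin n) :
    σ.jointEvent a (.disp i) = .null ∨ ∃ x v, σ.jointEvent a (.disp i) = .prop x v := by
  rw [jointEvent]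
  cases h : a (.disp i) <;> simp [event]
  split <;> simp

end MemState

/-! ### Runs: written items and numbers of propagations -/

theorem ncard_lt_succ_of_pos (p : ℕ → Prop) {t : ℕ} (h : p t) :
    {s | s < t + 1 ∧ p s}.ncard = {s | s < t ∧ p s}.ncard + 1 := by
  have hset : {s | s < t + 1 ∧ p s} = insert t {s | s < t ∧ p s} := by
    ext s
    simp only [Set.mem_ofPred_eq, Set.mem_insert_iff, Nat.lt_succ_iff_lt_or_eq]
    constructor
    · rintro ⟨h | h, h'⟩
      · exact .inr ⟨h, h'⟩
      · exact .inl h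
    · rintro (rfl | ⟨h, h'⟩)
      · exact ⟨.inr rfl, h⟩
      · exact ⟨.inl h, h'⟩
  rw [hset, Set.ncard_insert_of_notMem (by simp)
    ((Set.finite_lt_nat t).subset fun s hs => hs.1)]

theorem ncard_lt_succ_of_neg (p : ℕ → Prop) {t : ℕ} (h : ¬ p t) :
    {s | s < t + 1 ∧ p s}.ncard = {s | s < t ∧ p s}.ncard := by
  congr 1
  ext s
  simp only [Set.mem_ofPred_eq, Nat.lt_succ_iff_lt_or_eq]
  constructor
  · rintro ⟨h' | rfl, hp⟩
    · exact ⟨h', hp⟩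
    · exact absurd hp h
  · exact fun ⟨h, h'⟩ => ⟨.inl h, h'⟩

namespace Run

variable {n : ℕ} {Var Val Intl Op : Type*} [DecidableEq Var]

/-- The items written by `i` before time `t`, oldest first. -/
def written (r : Run n Var Val Intl Op) (i : Fin n) : ℕ → List (Var × Val)
  | 0 => []
  | t + 1 => written r i t ++ (r.action (.proc i) t).items

/-- The number of propagations by `d_i` before time `t`. -/
def dispatched (r : Run n Var Val Intl Op) (i : Fin n) : ℕ → ℕ
  | 0 => 0
  | t + 1 => dispatched r i t + (r.action (.disp i) t).pops

variable (r : Run n Var Val Intl Op)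

theorem written_prefix (i : Fin n) {s t : ℕ} (h : s ≤ t) : r.written i s <+: r.written i t := by
  induction h with
  | refl => exact List.prefix_refl _
  | step _ ih => exact ih.trans (List.prefix_append _ _)

theorem written_getElem?_of_le (i : Fin n) {s t k : ℕ} {p : Var × Val} (h : s ≤ t)
    (hk : (r.written i s)[k]? = some p) : (r.written i t)[k]? = some p := by
  obtain ⟨l, hl⟩ := r.written_prefix i h
  rw [← hl, List.getElem?_append_left (List.getElem?_eq_some_iff.1 hk).1, hk]

theorem written_getElem?_unique (i : Fin n) {s t k : ℕ} {p q : Var × Val}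
    (hp : (r.written i s)[k]? = some p) (hq : (r.written i t)[k]? = some q) : p = q := by
  have h₁ := r.written_getElem?_of_le i (le_max_left s t) hp
  have h₂ := r.written_getElem?_of_le i (le_max_right s t) hq
  exact Option.some.inj (h₁.symm.trans h₂)

theorem length_written_mono (i : Fin n) : Monotone fun t => (r.written i t).length :=
  fun _ _ h => (r.written_prefix i h).length_le

/-- Items are numbered from 0 by the number of earlier writes, which identifies the write that
created an item. -/
theorem written_getElem?_iff (i : Fin n) (t k : ℕ) (x : Var) (v : Val) :
    (r.written i t)[k]? = some (x, v) ↔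
      ∃ s < t, r.action (.proc i) s = .write x v ∧ (r.written i s).length = k := by
  induction t with
  | zero => simp [written]
  | succ t ih =>
    rw [written]
    constructor
    · intro h
      rcases lt_or_ge k (r.written i t).length with hk | hk
      · rw [List.getElem?_append_left hk, ih] at h
        obtain ⟨s, hs, h⟩ := h
        exact ⟨s, by omega, h⟩
      · rw [List.getElem?_append_right hk] at h
        cases ha : r.action (.proc i) t <;> simp only [ha, Action.items, List.getElem?_nil,
          reduceCtorEq] at h
        obtain ⟨h₁, h₂⟩ := List.getElem?_eq_some_iff.1 h
        simp only [List.length_singleton] at h₁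
        simp only [List.getElem_singleton, Prod.mk.injEq] at h₂
        exact ⟨t, by omega, by rw [ha, h₂.1, h₂.2], by omega⟩
    · rintro ⟨s, hs, h⟩
      rcases Nat.lt_succ_iff_lt_or_eq.1 hs with hs | rfl
      · have := ih.2 ⟨s, hs, h⟩
        rwa [List.getElem?_append_left (List.getElem?_eq_some_iff.1 this).1]
      · rw [h.1, ← h.2]
        simp [Action.items]

theorem dispatched_mono (i : Fin n) : Monotone (r.dispatched i) :=
  monotone_nat_of_le_succ fun t => by simp [dispatched]

theorem dispatched_succ_of_prop {i : Fin n} {t : ℕ} (h : r.action (.disp i) t = .prop) :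
    r.dispatched i (t + 1) = r.dispatched i t + 1 := by
  simp [dispatched, h, Action.pops]

theorem dispatched_succ_of_ne {i : Fin n} {t : ℕ} (h : r.action (.disp i) t ≠ .prop) :
    r.dispatched i (t + 1) = r.dispatched i t := by
  rw [dispatched]
  cases h' : r.action (.disp i) t <;> first | rfl | exact absurd h' h

/-- The counter grows in steps of one, so it passes through `k`; as the buffer is a queue, this
finds the propagation of item number `k`. -/
theorem exists_prop_of_lt_dispatched (i : Fin n) {t k : ℕ} (h : k < r.dispatched i t) :
    ∃ s < t, r.action (.disp i) s = .prop ∧ r.dispatched i s = k := by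
  induction t with
  | zero => simp [dispatched] at h
  | succ t ih =>
    by_cases ha : r.action (.disp i) t = .prop
    · rw [r.dispatched_succ_of_prop ha] at h
      rcases Nat.lt_succ_iff_lt_or_eq.1 h with h | rfl
      · obtain ⟨s, hs, h⟩ := ih h
        exact ⟨s, by omega, h⟩
      · exact ⟨t, by omega, ha, rfl⟩
    · rw [r.dispatched_succ_of_ne ha] at h
      obtain ⟨s, hs, h⟩ := ih h
      exact ⟨s, by omega, h⟩

theorem dispatched_le_of_forall (i : Fin n) (t c : ℕ)
    (h : ∀ s < t, r.action (.disp i) s = .prop → s < c) :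
    r.dispatched i t ≤ r.dispatched i c := by
  by_contra! hlt
  obtain ⟨s, hs, ha, hk⟩ := r.exists_prop_of_lt_dispatched i hlt
  have h₁ := r.dispatched_mono i (show s + 1 ≤ c from h s hs ha)
  rw [r.dispatched_succ_of_prop ha] at h₁
  omega

/-- The two claims need a joint induction: removing old items commutes with appending a new one only
if no more items are removed than were written. -/
theorem buf_eq_and_dispatched_le (i : Fin n) (t : ℕ) :
    (r.state t).tso.buf i = (r.written i t).drop (r.dispatched i t) ∧
      r.dispatched i t ≤ (r.written i t).length := by
  induction t with
  | zero => simp [r.buf_zero, written, dispatched]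
  | succ t ih =>
    have hle : r.dispatched i (t + 1) ≤ (r.written i t).length := by
      by_cases ha : r.action (.disp i) t = .prop
      · have hen := r.enabled t (.disp i)
        change r.action (.disp i) t = _ at ha
        rw [show (r.joint t).act (.disp i) = .prop from ha] at hen
        change (r.state t).tso.buf i ≠ [] at hen
        rw [ih.1, Ne, List.drop_eq_nil_iff] at hen
        rw [r.dispatched_succ_of_prop ha]
        omega
      · rw [r.dispatched_succ_of_ne ha]
        exact ih.2
    refine ⟨?_, hle.trans (r.length_written_mono i t.le_succ)⟩
    rw [r.tso_succ, MemState.next_buf, ih.1, List.drop_drop]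
    change (r.written i t).drop (r.dispatched i (t + 1)) ++ _ = _
    rw [written, List.drop_append_of_le_length hle]
    rfl

theorem buf_eq (i : Fin n) (t : ℕ) :
    (r.state t).tso.buf i = (r.written i t).drop (r.dispatched i t) :=
  (r.buf_eq_and_dispatched_le i t).1

theorem event_disp_eq_prop_iff (i : Fin n) (t : ℕ) (x : Var) (v : Val) :
    r.event (.disp i) t = .prop x v ↔
      r.action (.disp i) t = .prop ∧ (r.written i t)[r.dispatched i t]? = some (x, v) := by
  rw [event, MemState.jointEvent_disp_eq_prop_iff, buf_eq]
  simp [action]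

theorem exists_item_of_prop {i : Fin n} {t : ℕ} (h : r.action (.disp i) t = .prop) :
    ∃ x v, (r.written i t)[r.dispatched i t]? = some (x, v) := by
  have hen := r.enabled t (.disp i)
  rw [show (r.joint t).act (.disp i) = .prop from h] at hen
  change (r.state t).tso.buf i ≠ [] at hen
  rw [r.buf_eq, Ne, List.drop_eq_nil_iff, not_le] at hen
  exact ⟨_, _, List.getElem?_eq_getElem hen⟩

theorem event_disp_isProp_iff (i : Fin n) (t : ℕ) :
    (r.event (.disp i) t).IsProp ↔ r.action (.disp i) t = .prop := by
  constructor
  · rintro ⟨x, v, h⟩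
    exact ((r.event_disp_eq_prop_iff i t x v).1 h).1
  · intro h
    obtain ⟨x, v, hx⟩ := r.exists_item_of_prop h
    exact ⟨x, v, (r.event_disp_eq_prop_iff i t x v).2 ⟨h, hx⟩⟩

theorem event_proc_eq_write_iff (i : Fin n) (t : ℕ) (x : Var) (v : Val) :
    r.event (.proc i) t = .write x v ↔ r.action (.proc i) t = .write x v :=
  MemState.jointEvent_proc_eq_write_iff _ _ _ _ _

theorem event_proc_eq_rmw_iff (i : Fin n) (t : ℕ) (x : Var) (v w : Val) :
    r.event (.proc i) t = .rmw x v w ↔ r.action (.proc i) t = .rmw x v w :=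
  MemState.jointEvent_proc_eq_rmw_iff _ _ _ _ _ _

/-- The count is taken at `t + 1` because the dispatchers act first: a read no longer sees an item
that `d_i` removes in the same round. -/
theorem event_read {i : Fin n} {t : ℕ} {x : Var} (h : r.action (.proc i) t = .read x) :
    r.event (.proc i) t =
      match lookup ((r.written i t).drop (r.dispatched i (t + 1))) x with
      | some v => .rfb x v
      | none => .rfm x (((r.state t).tso.before (r.joint t).act (.proc i)).mem x) := by
  rw [event, MemState.jointEvent_read _ _ _ _ h, buf_eq, List.drop_drop]
  rfl

theorem action_of_event_rfb {i : Fin n} {t : ℕ} {x : Var} {v : Val}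
    (h : r.event (.proc i) t = .rfb x v) : r.action (.proc i) t = .read x := by
  rw [event, MemState.jointEvent] at h
  change MemState.event _ (.proc i) (r.action (.proc i) t) = _ at h
  cases ha : r.action (.proc i) t <;> simp only [ha, MemState.event, reduceCtorEq] at h
  split at h <;> simp_all

theorem action_of_event_rfm {i : Fin n} {t : ℕ} {x : Var} {v : Val}
    (h : r.event (.proc i) t = .rfm x v) : r.action (.proc i) t = .read x := by
  rw [event, MemState.jointEvent] at h
  change MemState.event _ (.proc i) (r.action (.proc i) t) = _ at h
  cases ha : r.action (.proc i) t <;> simp only [ha, MemState.event, reduceCtorEq] at h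
  split at h <;> simp_all

theorem event_read_cases {i : Fin n} {t : ℕ} {x : Var} (h : r.action (.proc i) t = .read x) :
    (∃ v, r.event (.proc i) t = .rfb x v) ∨ ∃ v, r.event (.proc i) t = .rfm x v := by
  rw [r.event_read h]
  split <;> simp

theorem lookup_of_event_rfb {i : Fin n} {t : ℕ} {x : Var} {v : Val}
    (h : r.event (.proc i) t = .rfb x v) :
    lookup ((r.written i t).drop (r.dispatched i (t + 1))) x = some v := by
  rw [r.event_read (r.action_of_event_rfb h)] at h
  split at h <;> simp_all

theorem lookup_of_event_rfm {i : Fin n} {t : ℕ} {x : Var} {v : Val}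
    (h : r.event (.proc i) t = .rfm x v) :
    lookup ((r.written i t).drop (r.dispatched i (t + 1))) x = none := by
  rw [r.event_read (r.action_of_event_rfm h)] at h
  split at h <;> simp_all

theorem event_disp_cases (i : Fin n) (t : ℕ) :
    r.event (.disp i) t = .null ∨ ∃ x v, r.event (.disp i) t = .prop x v :=
  MemState.jointEvent_disp_cases _ _ _

/-! ### Memory as the value of the last change -/

theorem changesMem_unique {b c : Agent n} {t : ℕ} {x : Var} (hb : (r.event b t).ChangesMem x)
    (hc : (r.event c t).ChangesMem x) : b = c := by
  by_contra hne
  refine r.nonconflicting t b c hne ⟨fun h => hb.not_isRfM h.1, ⟨x, hb.accesses, hc.accesses⟩, ?_⟩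
  rintro (⟨i, _, _, _, h⟩ | ⟨i, _, _, _, h⟩)
  · exact hc.not_isRfM h
  · exact hb.not_isRfM h

/-- A memory read of `x` can share its round with a change of `x` only by its own dispatcher. -/
theorem eq_disp_of_changesMem_of_rfm {b : Agent n} {i : Fin n} {t : ℕ} {x : Var} {v : Val}
    (hb : (r.event b t).ChangesMem x) (h : r.event (.proc i) t = .rfm x v) : b = .disp i := by
  by_contra hne
  have hbi : b ≠ .proc i := by
    rintro rfl
    exact hb.not_isRfM ⟨x, v, h⟩
  refine r.nonconflicting t b (.proc i) hbi
    ⟨fun h => hb.not_isRfM h.1, ⟨x, hb.accesses, .inr (.inr ⟨v, h⟩)⟩, ?_⟩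
  rintro (⟨j, hb', hi, _, _⟩ | ⟨j, hi, _⟩)
  · cases hi
    exact hne hb'
  · cases hi

/-- `v` is the value of `x` after the changes of `x` at the nodes in `D`. -/
def LastValue (D : Set (Node n)) (x : Var) (v : Val) : Prop :=
  (∃ b s, (b, s) ∈ D ∧ (r.event b s).Sets x v ∧
    ∀ c s', (c, s') ∈ D → (r.event c s').ChangesMem x → s' ≤ s) ∨
  ((∀ c s', (c, s') ∈ D → ¬ (r.event c s').ChangesMem x) ∧ v = (r.state 0).tso.mem x)

variable {r}

/-- Comparing the memories of two runs is thereby reduced to comparing the sets of changes of `x`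
that they have seen. -/
theorem LastValue.unique {D D' : Set (Node n)} {x : Var} {v w : Val}
    (hD : ∀ b s, (r.event b s).ChangesMem x → ((b, s) ∈ D ↔ (b, s) ∈ D'))
    (h : r.LastValue D x v) (h' : r.LastValue D' x w) : v = w := by
  rcases h with ⟨b, s, hm, hs, hl⟩ | ⟨hn, rfl⟩ <;>
    rcases h' with ⟨b', s', hm', hs', hl'⟩ | ⟨hn', rfl⟩
  · have h₁ := hl b' s' ((hD _ _ hs'.changesMem).2 hm') hs'.changesMem
    have h₂ := hl' b s ((hD _ _ hs.changesMem).1 hm) hs.changesMem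
    obtain rfl : s = s' := by omega
    obtain rfl := r.changesMem_unique hs.changesMem hs'.changesMem
    exact hs.unique hs'
  · exact absurd hs.changesMem (hn' _ _ ((hD _ _ hs.changesMem).1 hm))
  · exact absurd hs'.changesMem (hn _ _ ((hD _ _ hs'.changesMem).2 hm'))
  · rfl

theorem LastValue.congr {D D' : Set (Node n)} {x : Var} {v : Val}
    (hD : ∀ b s, (r.event b s).ChangesMem x → ((b, s) ∈ D ↔ (b, s) ∈ D'))
    (h : r.LastValue D x v) : r.LastValue D' x v := by
  rcases h with ⟨b, s, hm, hs, hl⟩ | ⟨hn, rfl⟩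
  · exact .inl ⟨b, s, (hD _ _ hs.changesMem).1 hm, hs,
      fun c s' hc hx => hl c s' ((hD _ _ hx).2 hc) hx⟩
  · exact .inr ⟨fun c s' hc hx => hn c s' ((hD _ _ hx).2 hc) hx, rfl⟩

variable (r)

theorem lastValue_mem (t : ℕ) (x : Var) :
    r.LastValue {θ | θ.2 < t} x ((r.state t).tso.mem x) := by
  induction t with
  | zero => exact .inr ⟨fun c s' h => absurd h (Nat.not_lt_zero _), rfl⟩
  | succ t ih =>
    rw [r.tso_succ]
    by_cases h : ∃ b, (r.event b t).ChangesMem x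
    · obtain ⟨b, hb⟩ := h
      obtain ⟨v, hv⟩ := Event.changesMem_iff.1 hb
      rw [MemState.next_mem_of_sets _ _ x v b hv
        (fun c hc hx => hc (r.changesMem_unique hx hb))]
      exact .inl ⟨b, t, Nat.lt_succ_self t, hv, fun c s' hs' _ => Nat.lt_succ_iff.1 hs'⟩
    · push Not at h
      rw [MemState.next_mem_of_not_changesMem _ _ x h]
      refine ih.congr fun b s hx => ?_
      have : s ≠ t := by rintro rfl; exact h b hx
      simp only [Set.mem_ofPred_eq]
      omega

/-- The time is `t + 1` because the own dispatcher may propagate to `x` in the same round, before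
the read; a process that changes `x` in this round would conflict with the read. -/
theorem rfm_value {i : Fin n} {t : ℕ} {x : Var} {v : Val}
    (h : r.event (.proc i) t = .rfm x v) : v = (r.state (t + 1)).tso.mem x := by
  have h' := h
  rw [r.event_read (r.action_of_event_rfm h), r.lookup_of_event_rfm h] at h'
  simp only [Event.rfm.injEq, true_and] at h'
  rw [← h', r.tso_succ]
  refine MemState.before_proc_mem _ _ _ _ fun j hj => ?_
  cases r.eq_disp_of_changesMem_of_rfm (b := .proc j) hj h

/-! ### Tags as positions in the queue -/

theorem writeCount_eq (i : Fin n) (t : ℕ) : r.writeCount i t = (r.written i (t + 1)).length := by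
  have key : ∀ t, {s | s < t ∧ (r.event (.proc i) s).IsWrite}.ncard
      = (r.written i t).length := by
    intro t
    induction t with
    | zero => simp [written]
    | succ t ih =>
      by_cases hw : (r.event (.proc i) t).IsWrite
      · rw [ncard_lt_succ_of_pos _ hw, ih]
        obtain ⟨x, v, hw⟩ := hw
        rw [event_proc_eq_write_iff] at hw
        simp [written, hw, Action.items]
      · rw [ncard_lt_succ_of_neg _ hw, ih, written]
        cases ha : r.action (.proc i) t with
        | write x v => exact absurd ⟨x, v, (r.event_proc_eq_write_iff i t x v).2 ha⟩ hw
        | _ => simp [Action.items]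
  rw [← key]
  simp [writeCount]

theorem propCount_eq (i : Fin n) (t : ℕ) : r.propCount i t = r.dispatched i (t + 1) := by
  have key : ∀ t, {s | s < t ∧ (r.event (.disp i) s).IsProp}.ncard = r.dispatched i t := by
    intro t
    induction t with
    | zero => simp [dispatched]
    | succ t ih =>
      by_cases hw : (r.event (.disp i) t).IsProp
      · rw [ncard_lt_succ_of_pos _ hw, ih,
          r.dispatched_succ_of_prop ((r.event_disp_isProp_iff i t).1 hw)]
      · rw [ncard_lt_succ_of_neg _ hw, ih,
          r.dispatched_succ_of_ne (mt (r.event_disp_isProp_iff i t).2 hw)]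
  rw [← key]
  simp [propCount]

theorem writeCount_eq_of_write {i : Fin n} {t : ℕ} {x : Var} {v : Val}
    (h : r.action (.proc i) t = .write x v) :
    r.writeCount i t = (r.written i t).length + 1 := by
  rw [writeCount_eq]
  simp [written, h, Action.items]

theorem propCount_eq_of_prop {i : Fin n} {t : ℕ} (h : r.action (.disp i) t = .prop) :
    r.propCount i t = r.dispatched i t + 1 := by
  rw [propCount_eq, r.dispatched_succ_of_prop h]

/-- The last item for `x` in the list of written items stems from the latest write to `x`. -/
theorem exists_latest_write {i : Fin n} {t k : ℕ} {x : Var} {v : Val}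
    (hk : (r.written i t)[k]? = some (x, v))
    (hlast : ∀ k', k < k' → ∀ w, (r.written i t)[k']? ≠ some (x, w)) :
    ∃ s < t, r.event (.proc i) s = .write x v ∧ (r.written i s).length = k ∧
      r.writeCount i s = k + 1 ∧
      ∀ u, s < u → u < t → ∀ w, r.event (.proc i) u ≠ .write x w := by
  obtain ⟨s, hs, ha, hl⟩ := (r.written_getElem?_iff i t k x v).1 hk
  have hcount := r.writeCount_eq_of_write ha
  refine ⟨s, hs, (r.event_proc_eq_write_iff i s x v).2 ha, hl, by rw [hcount, hl], ?_⟩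
  intro u hsu hut w hu
  rw [event_proc_eq_write_iff] at hu
  refine hlast (r.written i u).length ?_ w ((r.written_getElem?_iff i t _ x w).2 ⟨u, hut, hu, rfl⟩)
  have := r.length_written_mono i (show s + 1 ≤ u from hsu)
  rw [writeCount_eq] at hcount
  simp only at this
  omega

/-- The latest write and the latest change of `x` are unique. To identify the tags of an action in
two runs it is therefore enough to exhibit one common tag. -/
theorem HasTag.unique {r : Run n Var Val Intl Op} {b : Agent n} {t : ℕ} {κ κ' : Tag n}
    (h : r.HasTag b t κ) (h' : r.HasTag b t κ') : κ = κ' := by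
  cases h with
  | write i t h =>
    cases h' with
    | write => rfl
    | rfb _ s _ x v w h' => obtain ⟨_, _, h⟩ := h; rw [h'] at h; cases h
    | rfm _ _ s _ x v w h' => obtain ⟨_, _, h⟩ := h; rw [h'] at h; cases h
  | prop i t h =>
    cases h' with
    | prop => rfl
  | rfb i s t x v w h hst hs hlast =>
    cases h' with
    | write _ _ h' => obtain ⟨_, _, h'⟩ := h'; rw [h'] at h; cases h
    | rfb _ s' _ x' v' w' h' hst' hs' hlast' =>
      rw [h] at h'
      cases h'
      rcases lt_trichotomy s s' with hlt | rfl | hlt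
      · exact absurd hs' (hlast s' hlt hst' _)
      · rfl
      · exact absurd hs (hlast' s hlt hst _)
    | rfm _ _ s _ x v w h' => rw [h'] at h; cases h
  | rfm i j s t x v w h hst hs hlast =>
    cases h' with
    | write _ _ h' => obtain ⟨_, _, h'⟩ := h'; rw [h'] at h; cases h
    | rfb _ s' _ x' v' w' h' hst' hs' hlast' => rw [h'] at h; cases h
    | rfm _ j' s' _ x' v' w' h' hst' hs' hlast' =>
      rw [h] at h'
      cases h'
      have hc : (r.event (.disp j) s).ChangesMem x := .inr ⟨_, hs⟩
      have hc' : (r.event (.disp j') s').ChangesMem x := .inr ⟨_, hs'⟩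
      rcases lt_trichotomy s s' with hlt | rfl | hlt
      · exact absurd hc' (hlast s' hlt hst' _)
      · cases r.changesMem_unique hc hc'
        rfl
      · exact absurd hc (hlast' s hlt hst _)

end Run

/-! ### Rescheduling: clocks and buffers -/

/-- The number of local steps that `b` has taken before time `u`, if its step `t` takes place at
time `φ b t`. -/
noncomputable def clock {n : ℕ} (φ : Agent n → ℕ → ℕ) (b : Agent n) (u : ℕ) : ℕ :=
  sInf {t | u ≤ φ b t}

namespace Run

variable {n : ℕ} {Var Val Intl Op : Type*} [DecidableEq Var]

/-- A change of the times of the actions of the agents that respects the order at every agent and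
the occurs-before relation. -/
structure IsReschedule (r : Run n Var Val Intl Op) (φ : Agent n → ℕ → ℕ) : Prop where
  strictMono : ∀ b, StrictMono (φ b)
  lt_of_occursBefore : ∀ {b c t t'}, r.OccursBefore (b, t) (c, t') → φ b t < φ c t'

/-- The joint actions of the rescheduled run. -/
noncomputable def reJoint (r : Run n Var Val Intl Op) (φ : Agent n → ℕ → ℕ) (u : ℕ) :
    JointAction n Var Val Intl Op where
  -- The clock is the least step not taken before `u`, so for strictly increasing `φ b` the test
  -- says that `u` is the new time of some step of `b`.
  act b := if φ b (clock φ b u) = u then r.action b (clock φ b u) else .null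
  invoke i := if φ (.proc i) (clock φ (.proc i) u) = u
    then (r.joint (clock φ (.proc i) u)).invoke i else none

/-- The TSO states of the rescheduled run. -/
noncomputable def reTso (r : Run n Var Val Intl Op) (φ : Agent n → ℕ → ℕ) :
    ℕ → MemState n Var Val
  | 0 => (r.state 0).tso
  | u + 1 => (reTso r φ u).next (r.reJoint φ u).act

/-- The events of the rescheduled run. -/
noncomputable def reEvent (r : Run n Var Val Intl Op) (φ : Agent n → ℕ → ℕ) (b : Agent n)
    (u : ℕ) : Event Var Val Intl :=
  (r.reTso φ u).jointEvent (r.reJoint φ u).act b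

namespace IsReschedule

variable {r : Run n Var Val Intl Op} {φ : Agent n → ℕ → ℕ}

theorem lt_clock_iff (h : r.IsReschedule φ)
    (b : Agent n) (t u : ℕ) : t < clock φ b u ↔ φ b t < u := by
  -- The infimum is thus attained and not the default value for the empty set.
  have hne : {t | u ≤ φ b t}.Nonempty := ⟨u, (h.strictMono b).id_le u⟩
  constructor
  · intro ht
    by_contra! hu
    exact Nat.notMem_of_lt_sInf ht hu
  · intro ht
    by_contra! hu
    have h₁ : u ≤ φ b (clock φ b u) := Nat.sInf_mem hne
    have h₂ := (h.strictMono b).monotone hu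
    omega

theorem clock_mono (h : r.IsReschedule φ) (b : Agent n) : Monotone (clock φ b) := by
  intro u u' huu'
  by_contra! hlt
  rw [h.lt_clock_iff] at hlt
  exact absurd ((h.lt_clock_iff b _ u').2 (by omega)) (lt_irrefl _)

/-- A natural number is determined by the numbers below it; the values of the clock are computed in
this way. -/
theorem clock_eq_of_forall (h : r.IsReschedule φ)
    {b : Agent n} {t u : ℕ} (hu : ∀ s, φ b s < u ↔ s < t) :
    clock φ b u = t := by
  have h₁ := hu (clock φ b u)
  have h₂ := hu t
  rw [← h.lt_clock_iff] at h₁ h₂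
  omega

theorem clock_zero (h : r.IsReschedule φ) (b : Agent n) : clock φ b 0 = 0 :=
  h.clock_eq_of_forall (by simp)

theorem clock_apply (h : r.IsReschedule φ) (b : Agent n) (t : ℕ) : clock φ b (φ b t) = t :=
  h.clock_eq_of_forall fun _ => (h.strictMono b).lt_iff_lt

theorem clock_apply_succ (h : r.IsReschedule φ)
    (b : Agent n) (t : ℕ) : clock φ b (φ b t + 1) = t + 1 :=
  h.clock_eq_of_forall fun s => by
    rw [Nat.lt_succ_iff, (h.strictMono b).le_iff_le, Nat.lt_succ_iff]

theorem clock_succ_of_ne (h : r.IsReschedule φ) {b : Agent n} {u : ℕ} (hu : φ b (clock φ b u) ≠ u) :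
    clock φ b (u + 1) = clock φ b u :=
  h.clock_eq_of_forall fun s => by
    rw [h.lt_clock_iff, Nat.lt_succ_iff_lt_or_eq, or_iff_left]
    rintro rfl
    exact hu (by rw [h.clock_apply])

theorem act_apply (h : r.IsReschedule φ)
    (b : Agent n) (t : ℕ) : (r.reJoint φ (φ b t)).act b = r.action b t := by
  simp [reJoint, h.clock_apply]

theorem invoke_apply (h : r.IsReschedule φ) (i : Fin n) (t : ℕ) :
    (r.reJoint φ (φ (.proc i) t)).invoke i = (r.joint t).invoke i := by
  simp [reJoint, h.clock_apply]

theorem exists_of_act_ne_null {b : Agent n} {u : ℕ} (hb : (r.reJoint φ u).act b ≠ .null) :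
    ∃ t, φ b t = u := by
  by_contra! hne
  exact hb (if_neg (hne _))

theorem dispatched_clock_succ (h : r.IsReschedule φ) (i : Fin n) (u : ℕ) :
    r.dispatched i (clock φ (.disp i) (u + 1)) =
      r.dispatched i (clock φ (.disp i) u) + ((r.reJoint φ u).act (.disp i)).pops := by
  by_cases hu : φ (.disp i) (clock φ (.disp i) u) = u
  · generalize clock φ (.disp i) u = t at hu
    subst hu
    rw [h.clock_apply_succ, h.act_apply, dispatched]
  · rw [h.clock_succ_of_ne hu]
    simp [reJoint, hu, Action.pops]

theorem written_clock_succ (h : r.IsReschedule φ) (i : Fin n) (u : ℕ) :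
    r.written i (clock φ (.proc i) (u + 1)) =
      r.written i (clock φ (.proc i) u) ++ ((r.reJoint φ u).act (.proc i)).items := by
  by_cases hu : φ (.proc i) (clock φ (.proc i) u) = u
  · generalize clock φ (.proc i) u = t at hu
    subst hu
    rw [h.clock_apply_succ, h.act_apply, written]
  · rw [h.clock_succ_of_ne hu]
    simp [reJoint, hu, Action.items]

/-- An item is written before it is propagated, also after rescheduling. -/
theorem item_of_prop (h : r.IsReschedule φ) {i : Fin n} {s : ℕ} {x : Var} {v : Val}
    (hs : r.event (.disp i) s = .prop x v) :
    (r.written i (clock φ (.proc i) (φ (.disp i) s)))[r.dispatched i s]? = some (x, v) := by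
  obtain ⟨ha, hx⟩ := (r.event_disp_eq_prop_iff i s x v).1 hs
  obtain ⟨w, hws, hw, hl⟩ := (r.written_getElem?_iff i s _ x v).1 hx
  have hwrite : (r.event (.proc i) w).IsWrite := ⟨x, v, (r.event_proc_eq_write_iff i w x v).2 hw⟩
  have hprop : (r.event (.disp i) s).IsProp := ⟨x, v, hs⟩
  -- Item number `k` has the tag `k + 1` both at its write and at its propagation, so clause 2
  -- applies.
  have htag := HasTag.write i w hwrite
  rw [r.writeCount_eq_of_write hw, hl, ← r.propCount_eq_of_prop ha] at htag
  have hlt := h.lt_of_occursBefore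
    (.buffer i w s hws _ (.inl hwrite) hprop htag (HasTag.prop i s hprop))
  rw [← h.lt_clock_iff] at hlt
  exact (r.written_getElem?_iff i _ _ x v).2 ⟨w, hlt, hw, hl⟩

/-- The times differ by one because `d_i` acts before `i`: an item removed in round `u` must have
been written in an earlier round. -/
theorem dispatched_le_written (h : r.IsReschedule φ) (i : Fin n) (u : ℕ) :
    r.dispatched i (clock φ (.disp i) (u + 1)) ≤
      (r.written i (clock φ (.proc i) u)).length := by
  by_contra! hlt
  obtain ⟨s, hs, ha, hk⟩ := r.exists_prop_of_lt_dispatched i hlt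
  rw [h.lt_clock_iff, Nat.lt_succ_iff] at hs
  obtain ⟨x, v, hx⟩ := (r.event_disp_isProp_iff i s).2 ha
  have h₁ := r.written_getElem?_of_le i (h.clock_mono (.proc i) hs) (h.item_of_prop hx)
  have h₂ := (List.getElem?_eq_some_iff.1 h₁).1
  omega

theorem reTso_buf (h : r.IsReschedule φ) (i : Fin n) (u : ℕ) :
    (r.reTso φ u).buf i =
      (r.written i (clock φ (.proc i) u)).drop (r.dispatched i (clock φ (.disp i) u)) := by
  induction u with
  | zero => simp [reTso, h.clock_zero, r.buf_zero, written]
  | succ u ih =>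
    rw [reTso, MemState.next_buf, ih, List.drop_drop, ← h.dispatched_clock_succ,
      h.written_clock_succ, List.drop_append_of_le_length (h.dispatched_le_written i u)]

theorem reEvent_of_ne {b : Agent n} {u : ℕ} (hu : ∀ t, φ b t ≠ u) : r.reEvent φ b u = .null :=
  MemState.jointEvent_of_null _ _ _ (if_neg (hu _))

theorem reEvent_disp (h : r.IsReschedule φ) (i : Fin n) (s : ℕ) :
    r.reEvent φ (.disp i) (φ (.disp i) s) = r.event (.disp i) s := by
  by_cases ha : r.action (.disp i) s = .prop
  · obtain ⟨x, v, hx⟩ := (r.event_disp_isProp_iff i s).2 ha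
    rw [hx, reEvent, MemState.jointEvent_disp_eq_prop_iff, h.act_apply, h.reTso_buf, h.clock_apply]
    exact ⟨ha, by simpa using h.item_of_prop hx⟩
  · have hn : r.action (.disp i) s = .null := by
      have hen := r.enabled s (.disp i)
      change MemState.Enabled _ _ (r.action (.disp i) s) at hen
      cases h' : r.action (.disp i) s <;> simp_all [MemState.Enabled]
    rw [event, reEvent, MemState.jointEvent_of_null _ _ _ ((h.act_apply _ _).trans hn),
      MemState.jointEvent_of_null _ _ _ hn]

theorem reEvent_proc_of_not_read (h : r.IsReschedule φ)
    {i : Fin n} {t : ℕ} (hr : ∀ x, r.action (.proc i) t ≠ .read x) :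
    r.reEvent φ (.proc i) (φ (.proc i) t) = r.event (.proc i) t := by
  refine MemState.jointEvent_proc_of_not_read _ _ _ _ i (h.act_apply _ _) fun x hx => ?_
  rw [h.act_apply] at hx
  exact hr x hx

/-- The written items are those of the given run at `t`; only the progress of `d_i` and the memory
can differ. -/
theorem reEvent_read (h : r.IsReschedule φ)
    {i : Fin n} {t : ℕ} {x : Var} (ha : r.action (.proc i) t = .read x) :
    r.reEvent φ (.proc i) (φ (.proc i) t) =
      match lookup ((r.written i t).drop
        (r.dispatched i (clock φ (.disp i) (φ (.proc i) t + 1)))) x with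
      | some v => .rfb x v
      | none => .rfm x (((r.reTso φ (φ (.proc i) t)).before
          (r.reJoint φ (φ (.proc i) t)).act (.proc i)).mem x) := by
  rw [reEvent, MemState.jointEvent_read _ _ _ _ ((h.act_apply _ _).trans ha), h.reTso_buf,
    List.drop_drop, ← h.dispatched_clock_succ, h.clock_apply]

/-! ### Rescheduling: changes of memory -/

theorem reEvent_of_changesMem (h : r.IsReschedule φ) {b : Agent n} {s : ℕ} {x : Var}
    (hc : (r.event b s).ChangesMem x) : r.reEvent φ b (φ b s) = r.event b s := by
  cases b with
  | disp i => exact h.reEvent_disp i s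
  | proc i =>
    refine h.reEvent_proc_of_not_read fun y hy => ?_
    rcases hc with ⟨v, w, hc⟩ | ⟨v, hc⟩
    · rw [event_proc_eq_rmw_iff, hy] at hc
      cases hc
    · exact MemState.jointEvent_proc_ne_prop _ _ _ _ _ hc

theorem exists_of_reEvent_changesMem (h : r.IsReschedule φ) {b : Agent n} {u : ℕ} {x : Var}
    (hc : (r.reEvent φ b u).ChangesMem x) :
    ∃ s, φ b s = u ∧ (r.event b s).ChangesMem x := by
  by_cases hu : ∃ s, φ b s = u
  · obtain ⟨s, rfl⟩ := hu
    refine ⟨s, rfl, ?_⟩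
    cases b with
    | disp i => rwa [h.reEvent_disp] at hc
    | proc i =>
      rwa [h.reEvent_proc_of_not_read] at hc
      intro y hy
      rw [h.reEvent_read hy] at hc
      split at hc <;> rcases hc with ⟨_, _, hc⟩ | ⟨_, hc⟩ <;> cases hc
  · push Not at hu
    rw [reEvent_of_ne hu] at hc
    rcases hc with ⟨_, _, hc⟩ | ⟨_, hc⟩ <;> cases hc

theorem lt_of_changesMem (h : r.IsReschedule φ) {b c : Agent n} {s t : ℕ} {x : Var} (hst : s < t)
    (hb : (r.event b s).ChangesMem x) (hc : (r.event c t).ChangesMem x) : φ b s < φ c t :=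
  h.lt_of_occursBefore (.access b c s t hst x hb.accesses hc.accesses
    (fun hR => hb.not_isRfM hR.1) (fun ⟨_, _, _, _, hR⟩ => hc.not_isRfM hR))

theorem lt_of_changesMem_of_rfm (h : r.IsReschedule φ)
    {b : Agent n} {i : Fin n} {s t : ℕ} {x : Var} {v : Val}
    (hst : s < t) (hb : (r.event b s).ChangesMem x) (hi : r.event (.proc i) t = .rfm x v)
    (hne : b ≠ .disp i) : φ b s < φ (.proc i) t := by
  refine h.lt_of_occursBefore (.access b _ s t hst x hb.accesses (.inr (.inr ⟨v, hi⟩))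
    (fun hR => hb.not_isRfM hR.1) ?_)
  rintro ⟨j, rfl, hj, -⟩
  cases hj
  exact hne rfl

/-- Here `b` may be `d_i`: the exception in clause 3 only concerns a propagation that precedes the
read. -/
theorem lt_of_rfm_of_changesMem (h : r.IsReschedule φ)
    {b : Agent n} {i : Fin n} {s t : ℕ} {x : Var} {v : Val}
    (hst : t < s) (hi : r.event (.proc i) t = .rfm x v) (hb : (r.event b s).ChangesMem x) :
    φ (.proc i) t < φ b s :=
  h.lt_of_occursBefore (.access _ b t s hst x (.inr (.inr ⟨v, hi⟩)) hb.accesses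
    (fun hR => hb.not_isRfM hR.2) (fun ⟨_, hj, _⟩ => by cases hj))

theorem eq_of_changesMem (h : r.IsReschedule φ)
    {b c : Agent n} {s t : ℕ} {x : Var} (hst : φ b s = φ c t)
    (hb : (r.event b s).ChangesMem x) (hc : (r.event c t).ChangesMem x) : b = c ∧ s = t := by
  rcases lt_trichotomy s t with hlt | rfl | hlt
  · exact absurd hst (h.lt_of_changesMem hlt hb hc).ne
  · exact ⟨r.changesMem_unique hb hc, rfl⟩
  · exact absurd hst (h.lt_of_changesMem hlt hc hb).ne'

/-- The last change is determined by the times of the given run, although the set is cut off by the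
new times; this is consistent because changes of `x` keep their order. -/
theorem lastValue_reTso_mem (h : r.IsReschedule φ) (u : ℕ) (x : Var) :
    r.LastValue {θ | φ θ.1 θ.2 < u} x ((r.reTso φ u).mem x) := by
  induction u with
  | zero => exact .inr ⟨fun c s' h => absurd h (Nat.not_lt_zero _), rfl⟩
  | succ u ih =>
    rw [reTso]
    by_cases hch : ∃ b, (r.reEvent φ b u).ChangesMem x
    · obtain ⟨b, hb⟩ := hch
      obtain ⟨s, rfl, hs⟩ := h.exists_of_reEvent_changesMem hb
      obtain ⟨v, hv⟩ := Event.changesMem_iff.1 hs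
      have hv' : (r.reEvent φ b (φ b s)).Sets x v := by rwa [h.reEvent_of_changesMem hs]
      rw [MemState.next_mem_of_sets _ _ x v b hv']
      · refine .inl ⟨b, s, Nat.lt_succ_self _, hv, fun c s' hs' hc => ?_⟩
        by_contra! hlt
        have h₁ := h.lt_of_changesMem hlt hs hc
        simp only [Set.mem_ofPred_eq] at hs'
        omega
      · intro c hcb hc
        obtain ⟨s', hs', hc⟩ := h.exists_of_reEvent_changesMem (b := c) hc
        exact hcb (h.eq_of_changesMem hs' hc hs).1
    · push Not at hch
      rw [MemState.next_mem_of_not_changesMem _ _ x hch]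
      refine ih.congr fun b s hx => ?_
      have hne : φ b s ≠ u := by
        rintro rfl
        exact hch b (by rwa [h.reEvent_of_changesMem hx])
      simp only [Set.mem_ofPred_eq]
      omega

/-! ### Rescheduling: reads -/

/-- A read from the buffer remains one, and reads the same item. -/
theorem reEvent_of_rfb (h : r.IsReschedule φ) {i : Fin n} {t : ℕ} {x : Var} {v : Val}
    (ht : r.event (.proc i) t = .rfb x v) :
    r.reEvent φ (.proc i) (φ (.proc i) t) = .rfb x v := by
  obtain ⟨k, hpk, hk, hlast⟩ := (lookup_drop_eq_some_iff _ _ _ _).1 (r.lookup_of_event_rfb ht)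
  have hle : r.dispatched i (clock φ (.disp i) (φ (.proc i) t + 1)) ≤ k := by
    by_contra! hlt
    obtain ⟨s, hs, ha, hsk⟩ := r.exists_prop_of_lt_dispatched i hlt
    rw [h.lt_clock_iff] at hs
    -- In the given run the item is still in the buffer at the read, so its propagation comes later,
    -- and clause 2 keeps it later.
    have hts : t < s := by
      by_contra! hst
      have := r.dispatched_mono i (Nat.succ_le_succ hst)
      rw [Nat.succ_eq_add_one, r.dispatched_succ_of_prop ha] at this
      simp only [Nat.succ_eq_add_one] at this
      omega
    obtain ⟨w, hwt, hw, -, hcount, hlatest⟩ := r.exists_latest_write hk hlast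
    have hprop := (r.event_disp_isProp_iff i s).2 ha
    have htag := HasTag.prop i s hprop
    rw [r.propCount_eq_of_prop ha, hsk, ← hcount] at htag
    have := h.lt_of_occursBefore (.buffer i t s hts _ (.inr ⟨x, v, ht⟩) hprop
      (.rfb i w t x v v ht hwt hw hlatest) htag)
    omega
  rw [h.reEvent_read (r.action_of_event_rfb ht),
    (lookup_drop_eq_some_iff _ _ x v).2 ⟨k, hle, hk, hlast⟩]

/-- If a read from memory becomes a read from the buffer, then it reads the same item, which is
the last one propagated to `x` before the read in the given run. -/
theorem rfm_of_lookup (h : r.IsReschedule φ) {i : Fin n} {t : ℕ} {x : Var} {v v' : Val}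
    (ht : r.event (.proc i) t = .rfm x v)
    (hl : lookup ((r.written i t).drop
      (r.dispatched i (clock φ (.disp i) (φ (.proc i) t + 1)))) x = some v') :
    v' = v ∧ ∃ w s, w < t ∧ s ≤ t ∧ r.event (.proc i) w = .write x v ∧
      r.event (.disp i) s = .prop x v ∧ r.writeCount i w = r.propCount i s ∧
      (∀ u, w < u → u < t → ∀ y, r.event (.proc i) u ≠ .write x y) ∧
      ∀ u, s < u → u ≤ t → ∀ c, ¬ (r.event c u).ChangesMem x := by
  obtain ⟨k, hpk, hk, hlast⟩ := (lookup_drop_eq_some_iff _ _ _ _).1 hl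
  obtain ⟨w, hwt, hw, -, hcount, hlatest⟩ := r.exists_latest_write hk hlast
  -- The given read is from memory, so item `k` had already been propagated, at a time `s ≤ t`.
  have hlt : k < r.dispatched i (t + 1) := by
    by_contra! hge
    exact (lookup_drop_eq_none_iff _ _ _).1 (r.lookup_of_event_rfm ht) k v' hge hk
  obtain ⟨s, hs, ha, rfl⟩ := r.exists_prop_of_lt_dispatched i hlt
  have hst : s ≤ t := Nat.lt_succ_iff.1 hs
  -- After rescheduling the item is still in the buffer, so its propagation has been moved past the
  -- read.
  have hus : φ (.proc i) t < φ (.disp i) s := by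
    by_contra! hle
    have h₁ := (h.lt_clock_iff (.disp i) s (φ (.proc i) t + 1)).2 (by omega)
    have h₂ := r.dispatched_mono i (show s + 1 ≤ _ from h₁)
    rw [r.dispatched_succ_of_prop ha] at h₂
    omega
  obtain ⟨y, z, hyz⟩ := r.exists_item_of_prop ha
  obtain ⟨rfl, rfl⟩ := Prod.mk.inj (r.written_getElem?_unique i hyz hk)
  have hprop : r.event (.disp i) s = .prop y z := (r.event_disp_eq_prop_iff i s y z).2 ⟨ha, hyz⟩
  have hchg : (r.event (.disp i) s).ChangesMem y := .inr ⟨z, hprop⟩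
  have hno : ∀ u, s < u → u ≤ t → ∀ c, ¬ (r.event c u).ChangesMem y := by
    intro u hsu hut c hc
    by_cases hci : c = .disp i
    -- Since `d_i` propagates in order, this would be a later item for `y`, already written at `t`.
    · subst hci
      rcases hc with ⟨_, _, hc⟩ | ⟨z', hc⟩
      · rcases r.event_disp_cases i u with h' | ⟨_, _, h'⟩ <;> rw [h'] at hc <;> cases hc
      · obtain ⟨-, hu⟩ := (r.event_disp_eq_prop_iff i u y z').1 hc
        refine hlast _ ?_ z' (r.written_getElem?_of_le i hut hu)
        have h₂ := r.dispatched_mono i (show s + 1 ≤ u from hsu)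
        rw [r.dispatched_succ_of_prop ha] at h₂
        omega
    -- A change by another agent is ordered between the propagation and the read, which contradicts
    -- `hus`.
    · have hut' : u ≠ t := by
        rintro rfl
        exact hci (r.eq_disp_of_changesMem_of_rfm hc ht)
      have h₁ := h.lt_of_changesMem hsu hchg hc
      have h₂ := h.lt_of_changesMem_of_rfm (lt_of_le_of_ne hut hut') hc ht hci
      omega
  have hv : z = v := by
    have h₁ : r.LastValue {θ | θ.2 < t + 1} y z :=
      .inl ⟨.disp i, s, hs, .inr hprop, fun c s' hs' hc => by
        by_contra! hlt'
        exact hno s' hlt' (Nat.lt_succ_iff.1 hs') c hc⟩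
    rw [r.rfm_value ht]
    exact h₁.unique (fun _ _ _ => Iff.rfl) (r.lastValue_mem (t + 1) y)
  subst hv
  exact ⟨rfl, w, s, hwt, hst, hw, hprop, by rw [hcount, r.propCount_eq_of_prop ha], hlatest, hno⟩

/-- If a read from memory remains one, then the changes of `x` before it remain the same. -/
theorem changesMem_le_iff_of_lookup (h : r.IsReschedule φ) {i : Fin n} {t : ℕ} {x : Var} {v : Val}
    (ht : r.event (.proc i) t = .rfm x v)
    (hl : lookup ((r.written i t).drop
      (r.dispatched i (clock φ (.disp i) (φ (.proc i) t + 1)))) x = none)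
    {b : Agent n} {s : ℕ} (hb : (r.event b s).ChangesMem x) :
    φ b s ≤ φ (.proc i) t ↔ s ≤ t := by
  rcases lt_or_ge t s with hlt | hge
  · have := h.lt_of_rfm_of_changesMem hlt ht hb
    omega
  · refine iff_of_true ?_ hge
    -- Clause 3 does not cover the own dispatcher; but a propagation moved past the read would leave
    -- its item for `x` in the buffer, contrary to `hl`.
    by_cases hbi : b = .disp i
    · subst hbi
      rcases hb with ⟨_, _, hc⟩ | ⟨z, hc⟩
      · rcases r.event_disp_cases i s with h' | ⟨_, _, h'⟩ <;> rw [h'] at hc <;> cases hc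
      · obtain ⟨-, hs⟩ := (r.event_disp_eq_prop_iff i s x z).1 hc
        by_contra! hlt
        refine (lookup_drop_eq_none_iff _ _ _).1 hl (r.dispatched i s) z ?_
          (r.written_getElem?_of_le i hge hs)
        refine r.dispatched_mono i ?_
        by_contra! hlt'
        rw [h.lt_clock_iff] at hlt'
        omega
    · have hne : s ≠ t := by
        rintro rfl
        exact hbi (r.eq_disp_of_changesMem_of_rfm hb ht)
      exact (h.lt_of_changesMem_of_rfm (lt_of_le_of_ne hge hne) hb ht hbi).le

theorem reEvent_of_rfm (h : r.IsReschedule φ) {i : Fin n} {t : ℕ} {x : Var} {v : Val}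
    (ht : r.event (.proc i) t = .rfm x v) :
    r.reEvent φ (.proc i) (φ (.proc i) t) =
      match lookup ((r.written i t).drop
        (r.dispatched i (clock φ (.disp i) (φ (.proc i) t + 1)))) x with
      | some _ => .rfb x v
      | none => .rfm x v := by
  rw [h.reEvent_read (r.action_of_event_rfm ht)]
  split
  · rename_i v' hl
    rw [(h.rfm_of_lookup ht hl).1]
  · rename_i hl
    congr 1
    rw [MemState.before_proc_mem]
    · have h₁ := h.lastValue_reTso_mem (φ (.proc i) t + 1) x
      refine (h₁.unique (fun b s hb => ?_) (r.lastValue_mem (t + 1) x)).trans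
        (r.rfm_value ht).symm
      simp only [Set.mem_ofPred_eq, Nat.lt_succ_iff]
      exact h.changesMem_le_iff_of_lookup ht hl hb
    · intro j hj
      obtain ⟨s, hs, hc⟩ := h.exists_of_reEvent_changesMem (b := .proc j) hj
      rcases lt_trichotomy s t with hlt | rfl | hlt
      · have := h.lt_of_changesMem_of_rfm hlt hc ht (by simp)
        omega
      · cases r.eq_disp_of_changesMem_of_rfm hc ht
      · have := h.lt_of_rfm_of_changesMem hlt ht hc
        omega

/-- An event remains the same, except that a read from memory may become a read from the buffer. -/
theorem reEvent_eq_or (h : r.IsReschedule φ) (b : Agent n) (t : ℕ) :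
    r.reEvent φ b (φ b t) = r.event b t ∨
      ∃ x v, r.event b t = .rfm x v ∧ r.reEvent φ b (φ b t) = .rfb x v := by
  cases b with
  | disp i => exact .inl (h.reEvent_disp i t)
  | proc i =>
    by_cases ha : ∃ x, r.action (.proc i) t = .read x
    · obtain ⟨x, ha⟩ := ha
      rcases r.event_read_cases ha with ⟨v, ht⟩ | ⟨v, ht⟩
      · rw [h.reEvent_of_rfb ht, ht]
        exact .inl rfl
      · rw [h.reEvent_of_rfm ht, ht]
        split
        · exact .inr ⟨x, v, rfl, rfl⟩
        · exact .inl rfl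
    · push Not at ha
      exact .inl (h.reEvent_proc_of_not_read ha)

theorem entries_reEvent (h : r.IsReschedule φ) (b : Agent n) (t : ℕ) :
    (r.reEvent φ b (φ b t)).entries Op = (r.event b t).entries Op := by
  rcases h.reEvent_eq_or b t with h' | ⟨x, v, h₁, h₂⟩
  · rw [h']
  · rw [h₁, h₂]
    rfl

/-- The only events that change become reads from the buffer, which are no memory accesses. So every
access of the new run is one of the given run. -/
theorem exists_of_reEvent_accesses (h : r.IsReschedule φ) {b : Agent n} {u : ℕ} {x : Var}
    (hb : (r.reEvent φ b u).Accesses x) :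
    ∃ t, φ b t = u ∧ r.reEvent φ b u = r.event b t := by
  by_cases hu : ∃ s, φ b s = u
  · obtain ⟨t, rfl⟩ := hu
    refine ⟨t, rfl, ?_⟩
    rcases h.reEvent_eq_or b t with h' | ⟨y, v, h₁, h₂⟩
    · exact h'
    · rw [h₂] at hb
      rcases hb with ⟨_, _, hb⟩ | ⟨_, hb⟩ | ⟨_, hb⟩ <;> cases hb
  · push Not at hu
    rw [reEvent_of_ne hu] at hb
    rcases hb with ⟨_, _, hb⟩ | ⟨_, hb⟩ | ⟨_, hb⟩ <;> cases hb

/-! ### Legality of the rescheduled run -/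

theorem not_conflicting (h : r.IsReschedule φ) (u : ℕ) (b c : Agent n) (hbc : b ≠ c) :
    ¬ Conflicting b (r.reEvent φ b u) c (r.reEvent φ c u) := by
  rintro ⟨hR, ⟨x, hb, hc⟩, hP⟩
  obtain ⟨s, hs, hbs⟩ := h.exists_of_reEvent_accesses hb
  obtain ⟨t, ht, hct⟩ := h.exists_of_reEvent_accesses hc
  rw [hbs, hct] at hR hP
  rw [hbs] at hb
  rw [hct] at hc
  rcases lt_trichotomy s t with hlt | rfl | hlt
  · have := h.lt_of_occursBefore (.access b c s t hlt x hb hc hR fun h' => hP (.inl h'))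
    omega
  · exact r.nonconflicting s b c hbc ⟨hR, ⟨x, hb, hc⟩, hP⟩
  · have := h.lt_of_occursBefore (.access c b t s hlt x hc hb (fun h' => hR h'.symm)
      fun h' => hP (.inr h'))
    omega

/-- Everything written before `t` was propagated before `t`, and clause 4 keeps these propagations
before the fence or RMW. -/
theorem buf_eq_nil (h : r.IsReschedule φ) {i : Fin n} {t : ℕ} (hbuf : (r.state t).tso.buf i = [])
    (ht : r.event (.proc i) t = .fence ∨ (r.event (.proc i) t).IsRMW) :
    (r.reTso φ (φ (.proc i) t)).buf i = [] := by
  rw [h.reTso_buf, h.clock_apply, List.drop_eq_nil_iff]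
  rw [r.buf_eq, List.drop_eq_nil_iff] at hbuf
  refine hbuf.trans (r.dispatched_le_of_forall i t _ fun s hs ha => ?_)
  rw [h.lt_clock_iff]
  exact h.lt_of_occursBefore (.fence i s t hs ((r.event_disp_isProp_iff i s).2 ha) ht)

/-- The RMW is itself a change of `x`, hence comparable with all others, and the same changes
precede it in both runs. -/
theorem mem_eq_of_rmw (h : r.IsReschedule φ) {i : Fin n} {t : ℕ} {x : Var} {v w : Val}
    (ht : r.event (.proc i) t = .rmw x v w) :
    (r.reTso φ (φ (.proc i) t)).mem x = (r.state t).tso.mem x := by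
  have hc : (r.event (.proc i) t).ChangesMem x := .inl ⟨v, w, ht⟩
  refine (h.lastValue_reTso_mem _ x).unique (fun b s hb => ?_) (r.lastValue_mem t x)
  simp only [Set.mem_ofPred_eq]
  rcases lt_trichotomy s t with hlt | rfl | hlt
  · exact iff_of_true (h.lt_of_changesMem hlt hb hc) hlt
  · cases r.changesMem_unique hb hc
    simp
  · exact iff_of_false (h.lt_of_changesMem hlt hc hb).not_gt hlt.not_gt

theorem enabled (h : r.IsReschedule φ) (u : ℕ) (b : Agent n) :
    (r.reTso φ u).Enabled b ((r.reJoint φ u).act b) := by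
  by_cases hu : ∃ t, φ b t = u
  · obtain ⟨t, rfl⟩ := hu
    rw [h.act_apply]
    have hen := r.enabled t b
    change (r.state t).tso.Enabled b (r.action b t) at hen
    cases b with
    | proc i =>
      cases ha : r.action (.proc i) t with
      | prop => rwa [ha] at hen
      | fence =>
        rw [ha] at hen
        refine h.buf_eq_nil hen (.inl ?_)
        rw [event, MemState.jointEvent, show (r.joint t).act (.proc i) = .fence from ha]
        rfl
      | rmw x v w =>
        rw [ha] at hen
        have ht := (r.event_proc_eq_rmw_iff i t x v w).2 ha
        exact ⟨h.buf_eq_nil hen.1 (.inr ⟨x, v, w, ht⟩), (h.mem_eq_of_rmw ht).trans hen.2⟩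
      | _ => trivial
    | disp i =>
      cases ha : r.action (.disp i) t with
      | prop =>
        obtain ⟨x, v, hx⟩ := (r.event_disp_isProp_iff i t).2 ha
        have hk := h.item_of_prop hx
        change (r.reTso φ (φ (.disp i) t)).buf i ≠ []
        rw [h.reTso_buf, h.clock_apply, Ne, List.drop_eq_nil_iff, not_le]
        exact (List.getElem?_eq_some_iff.1 hk).1
      | _ => rwa [ha] at hen
  · rw [show (r.reJoint φ u).act b = .null from if_neg fun h' => hu ⟨_, h'⟩]
    cases b <;> trivial

/-! ### The rescheduled run and its tags -/

/-- The rescheduled run. -/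
noncomputable def run (h : r.IsReschedule φ) : Run n Var Val Intl Op where
  -- The local states are read off the given run at the local clocks; `loc_succ` then has to show
  -- that the recomputed events leave the same records.
  state u := ⟨r.reTso φ u, fun i => r.loc i (clock φ (.proc i) u)⟩
  joint := r.reJoint φ
  buf_zero := r.buf_zero
  loc_zero i := by
    change r.loc i (clock φ (.proc i) 0) = []
    rw [h.clock_zero]
    exact r.loc_zero i
  enabled := h.enabled
  nonconflicting := h.not_conflicting
  tso_succ _ := rfl
  loc_succ u i := by
    change r.loc i (clock φ (.proc i) (u + 1)) = r.loc i (clock φ (.proc i) u) ++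
      (r.reEvent φ (.proc i) u).entries Op ++ _
    by_cases hu : ∃ t, φ (.proc i) t = u
    · obtain ⟨t, rfl⟩ := hu
      rw [h.clock_apply_succ, h.clock_apply, h.entries_reEvent, h.invoke_apply]
      exact r.loc_succ t i
    · push Not at hu
      rw [h.clock_succ_of_ne (hu _), reEvent_of_ne hu]
      simp [reJoint, hu, Event.entries]

theorem run_event (h : r.IsReschedule φ) (b : Agent n) (u : ℕ) :
    h.run.event b u = r.reEvent φ b u := rfl

theorem run_loc (h : r.IsReschedule φ) (i : Fin n) (u : ℕ) :
    h.run.loc i u = r.loc i (clock φ (.proc i) u) := rfl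

theorem run_state_zero (h : r.IsReschedule φ) : h.run.state 0 = r.state 0 := by
  refine GlobalState.ext rfl (funext fun i => ?_)
  change r.loc i (clock φ (.proc i) 0) = _
  rw [h.clock_zero]
  rfl

theorem run_action_apply (h : r.IsReschedule φ) (b : Agent n) (t : ℕ) :
    h.run.action b (φ b t) = r.action b t :=
  h.act_apply b t

theorem run_loc_apply (h : r.IsReschedule φ) (i : Fin n) (t : ℕ) :
    h.run.loc i (φ (.proc i) t) = r.loc i t := by
  rw [run_loc, h.clock_apply]

theorem run_isRunOf (h : r.IsReschedule φ) {P : Protocol n Var Val Intl Op} (hr : r.IsRunOf P) :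
    h.run.IsRunOf P := by
  intro u i hu
  obtain ⟨t, rfl⟩ := exists_of_act_ne_null hu
  rw [h.run_action_apply] at hu ⊢
  rw [h.run_loc_apply]
  exact hr t i hu

theorem run_locallyEquivalent (h : r.IsReschedule φ) : h.run.LocallyEquivalent r := by
  intro j ℓ
  constructor
  · rintro ⟨u, hu⟩
    exact ⟨_, hu⟩
  · rintro ⟨t, ht⟩
    exact ⟨_, (h.run_loc_apply j t).trans ht⟩

theorem run_written (h : r.IsReschedule φ) (i : Fin n) (u : ℕ) :
    h.run.written i u = r.written i (clock φ (.proc i) u) := by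
  induction u with
  | zero => rw [h.clock_zero]; rfl
  | succ u ih => rw [written, ih, h.written_clock_succ]; rfl

theorem run_dispatched (h : r.IsReschedule φ) (i : Fin n) (u : ℕ) :
    h.run.dispatched i u = r.dispatched i (clock φ (.disp i) u) := by
  induction u with
  | zero => rw [h.clock_zero]; rfl
  | succ u ih => rw [dispatched, ih, h.dispatched_clock_succ]; rfl

theorem run_writeCount (h : r.IsReschedule φ) (i : Fin n) (t : ℕ) :
    h.run.writeCount i (φ (.proc i) t) = r.writeCount i t := by
  rw [writeCount_eq, writeCount_eq, h.run_written, h.clock_apply_succ]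

theorem run_propCount (h : r.IsReschedule φ) (i : Fin n) (t : ℕ) :
    h.run.propCount i (φ (.disp i) t) = r.propCount i t := by
  rw [propCount_eq, propCount_eq, h.run_dispatched, h.clock_apply_succ]

theorem run_event_write_iff (h : r.IsReschedule φ) {i : Fin n} {t : ℕ} {x : Var} {v : Val} :
    h.run.event (.proc i) (φ (.proc i) t) = .write x v ↔ r.event (.proc i) t = .write x v := by
  rw [event_proc_eq_write_iff, event_proc_eq_write_iff, h.run_action_apply]

/-- The latest write to `x` before a read remains the latest one. -/
theorem run_hasTag_rfb (h : r.IsReschedule φ) {i : Fin n} {s t : ℕ} {x : Var} {v w : Val}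
    (ht : r.reEvent φ (.proc i) (φ (.proc i) t) = .rfb x v) (hst : s < t)
    (hs : r.event (.proc i) s = .write x w)
    (hlast : ∀ u, s < u → u < t → ∀ w', r.event (.proc i) u ≠ .write x w') :
    h.run.HasTag (.proc i) (φ (.proc i) t) (i, r.writeCount i s) := by
  rw [← h.run_writeCount]
  refine .rfb i _ _ x v w ht (h.strictMono _ hst) (h.run_event_write_iff.2 hs) ?_
  intro u hsu hut w' hu
  obtain ⟨u, rfl⟩ : ∃ u', φ (.proc i) u' = u := by
    refine exists_of_act_ne_null (r := r) ?_
    rw [event_proc_eq_write_iff] at hu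
    change (r.reJoint φ u).act (.proc i) = _ at hu
    simp [hu]
  exact hlast u ((h.strictMono _).lt_iff_lt.1 hsu) ((h.strictMono _).lt_iff_lt.1 hut) w'
    (h.run_event_write_iff.1 hu)

/-- For a read that is from memory in both runs, the tags are the same in both runs. -/
theorem run_hasTag_iff_of_rfm (h : r.IsReschedule φ) {i : Fin n} {t : ℕ} {x : Var} {v : Val}
    {κ : Tag n} (ht : r.event (.proc i) t = .rfm x v)
    (hl : lookup ((r.written i t).drop
      (r.dispatched i (clock φ (.disp i) (φ (.proc i) t + 1)))) x = none) :
    h.run.HasTag (.proc i) (φ (.proc i) t) κ ↔ r.HasTag (.proc i) t κ := by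
  have ht' : h.run.event (.proc i) (φ (.proc i) t) = .rfm x v := by
    rw [run_event, h.reEvent_of_rfm ht, hl]
  constructor
  · intro hκ
    generalize hu : φ (.proc i) t = u at hκ ht'
    cases hκ with
    | write _ _ hw => obtain ⟨_, _, hw⟩ := hw; rw [hw] at ht'; cases ht'
    | rfb _ _ _ _ _ _ hw => rw [hw] at ht'; cases ht'
    | rfm _ j s' _ x' v' w h' hst hs hlast =>
      subst hu
      rw [h'] at ht'
      cases ht'
      obtain ⟨s, rfl, hc⟩ := h.exists_of_reEvent_changesMem (b := .disp j) (u := s') (x := x)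
        (.inr ⟨w, hs⟩)
      rw [h.run_propCount]
      rw [run_event, h.reEvent_disp] at hs
      refine .rfm i j s t x v w ht ((h.changesMem_le_iff_of_lookup ht hl hc).1 hst) hs ?_
      intro u hsu hut c hcu
      refine hlast (φ c u) (h.lt_of_changesMem hsu hc hcu)
        ((h.changesMem_le_iff_of_lookup ht hl hcu).2 hut) c ?_
      rwa [run_event, h.reEvent_of_changesMem hcu]
  · intro hκ
    cases hκ with
    | write _ _ hw => obtain ⟨_, _, hw⟩ := hw; rw [hw] at ht; cases ht
    | rfb _ _ _ _ _ _ hw => rw [hw] at ht; cases ht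
    | rfm _ j s _ x' v' w h' hst hs hlast =>
      rw [h'] at ht
      cases ht
      have hc : (r.event (.disp j) s).ChangesMem x := .inr ⟨w, hs⟩
      rw [← h.run_propCount]
      refine .rfm i j _ _ x v w ht' ((h.changesMem_le_iff_of_lookup h' hl hc).2 hst)
        (by rw [run_event, h.reEvent_disp, hs]) ?_
      intro u hsu hut c hcu
      obtain ⟨u, rfl, hc'⟩ := h.exists_of_reEvent_changesMem hcu
      refine hlast u ?_ ((h.changesMem_le_iff_of_lookup h' hl hc').1 hut) c hc'
      rcases lt_trichotomy s u with hlt | rfl | hlt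
      · exact hlt
      · cases r.changesMem_unique hc hc'
        exact absurd hsu (lt_irrefl _)
      · have := h.lt_of_changesMem hlt hc' hc
        omega

/-- One common tag suffices by `HasTag.unique`, where there is one. A read from memory may have no
tag, if its value is initial or stems from an RMW, so reads that stay reads from memory need
`run_hasTag_iff_of_rfm`. -/
theorem run_hasTag_iff (h : r.IsReschedule φ) (b : Agent n) (t : ℕ) (κ : Tag n) :
    h.run.HasTag b (φ b t) κ ↔ r.HasTag b t κ := by
  have of_common : ∀ {κ₀ : Tag n}, h.run.HasTag b (φ b t) κ₀ → r.HasTag b t κ₀ →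
      (h.run.HasTag b (φ b t) κ ↔ r.HasTag b t κ) := fun h₁ h₂ =>
    ⟨fun h' => h₁.unique h' ▸ h₂, fun h' => h₂.unique h' ▸ h₁⟩
  cases b with
  | disp i =>
    by_cases ha : r.action (.disp i) t = .prop
    · have hp := (r.event_disp_isProp_iff i t).2 ha
      have hp' : (h.run.event (.disp i) (φ (.disp i) t)).IsProp := by
        rwa [run_event, h.reEvent_disp]
      have htag := HasTag.prop i _ hp'
      rw [h.run_propCount] at htag
      exact of_common htag (.prop i t hp)
    · have hn : ¬ (r.event (.disp i) t).IsProp := mt (r.event_disp_isProp_iff i t).1 ha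
      refine iff_of_false (fun hκ => ?_) (fun hκ => ?_)
      · generalize hu : φ (.disp i) t = u at hκ
        cases hκ with
        | prop _ _ hp => rw [← hu, run_event, h.reEvent_disp] at hp; exact hn hp
      · cases hκ with
        | prop _ _ hp => exact hn hp
  | proc i =>
    by_cases ha : ∃ x, r.action (.proc i) t = .read x
    · obtain ⟨x, ha⟩ := ha
      rcases r.event_read_cases ha with ⟨v, ht⟩ | ⟨v, ht⟩
      · obtain ⟨k, -, hk, hlast⟩ := (lookup_drop_eq_some_iff _ _ _ _).1 (r.lookup_of_event_rfb ht)
        obtain ⟨s, hst, hs, -, -, hlatest⟩ := r.exists_latest_write hk hlast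
        exact of_common (h.run_hasTag_rfb (h.reEvent_of_rfb ht) hst hs hlatest)
          (.rfb i s t x v v ht hst hs hlatest)
      · cases hl : lookup ((r.written i t).drop
          (r.dispatched i (clock φ (.disp i) (φ (.proc i) t + 1)))) x with
        | none => exact h.run_hasTag_iff_of_rfm ht hl
        | some v' =>
          obtain ⟨-, w, s, hwt, hst, hw, hs, hcount, hlatest, hno⟩ := h.rfm_of_lookup ht hl
          have ht' : r.reEvent φ (.proc i) (φ (.proc i) t) = .rfb x v := by
            rw [h.reEvent_of_rfm ht, hl]
          have htag := h.run_hasTag_rfb ht' hwt hw hlatest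
          -- The new tag names the item by its write, the old one by its propagation; the two counts
          -- agree.
          rw [hcount] at htag
          exact of_common htag (.rfm i i s t x v v ht hst hs hno)
    · push Not at ha
      have hev : h.run.event (.proc i) (φ (.proc i) t) = r.event (.proc i) t :=
        h.reEvent_proc_of_not_read ha
      by_cases hw : (r.event (.proc i) t).IsWrite
      · have htag := HasTag.write i _ (show (h.run.event _ _).IsWrite by rwa [hev])
        rw [h.run_writeCount] at htag
        exact of_common htag (.write i t hw)
      · have hnb : ∀ x v, r.event (.proc i) t ≠ .rfb x v := fun x v h' =>
          ha x (r.action_of_event_rfb h')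
        have hnm : ∀ x v, r.event (.proc i) t ≠ .rfm x v := fun x v h' =>
          ha x (r.action_of_event_rfm h')
        refine iff_of_false (fun hκ => ?_) (fun hκ => ?_)
        · generalize φ (.proc i) t = u at hκ hev
          cases hκ with
          | write _ _ hp => exact hw (hev ▸ hp)
          | rfb _ _ _ _ _ _ hp => exact hnb _ _ (hev ▸ hp)
          | rfm _ _ _ _ _ _ _ hp => exact hnm _ _ (hev ▸ hp)
        · cases hκ with
          | write _ _ hp => exact hw hp
          | rfb _ _ _ _ _ _ hp => exact hnb _ _ hp
          | rfm _ _ _ _ _ _ _ hp => exact hnm _ _ hp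

end IsReschedule

/-! ### Delaying the nodes outside the past of `S` -/

theorem OccursBefore.lt {r : Run n Var Val Intl Op} {θ θ' : Node n} (h : r.OccursBefore θ θ') :
    θ.2 < θ'.2 := by
  induction h with
  | locality _ _ _ ht => exact ht
  | buffer _ _ _ ht => exact ht
  | access _ _ _ _ ht => exact ht
  | fence _ _ _ ht => exact ht
  | trans _ _ _ _ _ ih ih' => exact ih.trans ih'

theorem mem_past_of_occursBefore {r : Run n Var Val Intl Op} {S : Set (Node n)} {θ θ' : Node n}
    (h : r.OccursBefore θ θ') (hθ' : θ' ∈ r.PastPlus S) : θ ∈ r.Past S := by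
  rcases hθ' with ⟨θ'', hS, h'⟩ | hS
  · exact ⟨θ'', hS, h.trans _ _ _ h'⟩
  · exact ⟨θ', hS, h⟩

theorem le_newTime (r : Run n Var Val Intl Op) (S : Set (Node n)) (Δ : ℕ) (b : Agent n) (t : ℕ) :
    t ≤ r.newTime S Δ b t := by
  unfold newTime
  split_ifs <;> omega

theorem newTime_le (r : Run n Var Val Intl Op) (S : Set (Node n)) (Δ : ℕ) (b : Agent n) (t : ℕ) :
    r.newTime S Δ b t ≤ t + Δ := by
  unfold newTime
  split_ifs <;> omega

/-- If the later node is in the past of `S`, so is the earlier one, and both stay. Otherwise the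
later node gets the full delay, and the earlier one at most that. -/
theorem newTime_lt_newTime {r : Run n Var Val Intl Op} (S : Set (Node n)) (Δ : ℕ) {b c : Agent n}
    {t t' : ℕ} (h : r.OccursBefore (b, t) (c, t')) :
    r.newTime S Δ b t < r.newTime S Δ c t' := by
  have hlt : t < t' := h.lt
  by_cases hc : (c, t') ∈ r.Past S
  · have hb := mem_past_of_occursBefore h (Or.inl hc)
    rwa [newTime, newTime, if_pos hb, if_pos hc]
  · have := r.newTime_le S Δ b t
    rw [show r.newTime S Δ c t' = t' + Δ from if_neg hc]
    omega

/-- Delaying the nodes that are not in the past of `S` is a rescheduling. -/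
theorem isReschedule_newTime (r : Run n Var Val Intl Op) (S : Set (Node n)) (Δ : ℕ) :
    r.IsReschedule (r.newTime S Δ) where
  strictMono b t t' h := newTime_lt_newTime S Δ (.locality b t t' h)
  lt_of_occursBefore h := newTime_lt_newTime S Δ h

/-- The clock counts only steps strictly before `t`, and these are in the past of `S` by locality.
So nodes of `S` may be included even if their own actions are delayed. -/
theorem clock_newTime_of_mem {r : Run n Var Val Intl Op} {S : Set (Node n)} (Δ : ℕ) {b : Agent n}
    {t : ℕ} (h : (b, t) ∈ r.PastPlus S) : clock (r.newTime S Δ) b t = t := by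
  refine (r.isReschedule_newTime S Δ).clock_eq_of_forall fun s => ⟨fun hs => ?_, fun hs => ?_⟩
  · exact (r.le_newTime S Δ b s).trans_lt hs
  · rwa [newTime, if_pos (mem_past_of_occursBefore (.locality b s t hs) h)]

/-- By locality no step of `b` from `t` on is in the past of `S`, so these steps happen at `t + Δ`
or later; the earlier ones happen before `t + Δ`, delayed or not. -/
theorem clock_newTime_of_notMem {r : Run n Var Val Intl Op} {S : Set (Node n)} (Δ : ℕ)
    {b : Agent n} {t : ℕ} (h : (b, t) ∉ r.PastPlus S) :
    clock (r.newTime S Δ) b (t + Δ) = t := by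
  refine (r.isReschedule_newTime S Δ).clock_eq_of_forall fun s => ⟨fun hs => ?_, fun hs => ?_⟩
  · by_contra! hts
    have hsP : (b, s) ∉ r.Past S := by
      intro hsP
      rcases hts.lt_or_eq with hlt | rfl
      · exact h (.inl (mem_past_of_occursBefore (.locality b t s hlt) (.inl hsP)))
      · exact h (.inl hsP)
    rw [newTime, if_neg hsP] at hs
    omega
  · have := r.newTime_le S Δ b s
    omega

end Run

end TSO

theorem mainTheorem1 {n : ℕ} {Var Val Intl Op : Type*} [DecidableEq Var]
    (P : TSO.Protocol n Var Val Intl Op) (r : TSO.Run n Var Val Intl Op) (hr : r.IsRunOf P)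
    (S : Set (TSO.Node n)) (hS : S.Finite) (Δ : ℕ) :
    ∃ r' : TSO.Run n Var Val Intl Op,
      r'.IsRunOf P ∧ r'.LocallyEquivalent r ∧ r'.state 0 = r.state 0 ∧
      -- (a) the same actions, with the same tags, in the same order, at the new times
      (∀ b, StrictMono (r.newTime S Δ b) ∧
        (∀ t, r'.action b (r.newTime S Δ b t) = r.action b t) ∧
        (∀ t κ, r'.HasTag b (r.newTime S Δ b t) κ ↔ r.HasTag b t κ) ∧
        (∀ t', r'.action b t' ≠ .null → ∃ t, r.newTime S Δ b t = t')) ∧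
      -- (b) the local states are shifted accordingly
      (∀ j t, ((TSO.Agent.proc j, t) ∈ r.PastPlus S → r.loc j t = r'.loc j t) ∧
        ((TSO.Agent.proc j, t) ∉ r.PastPlus S → r.loc j t = r'.loc j (t + Δ))) := by
  have h := r.isReschedule_newTime S Δ
  refine ⟨h.run, h.run_isRunOf hr, h.run_locallyEquivalent, h.run_state_zero,
    fun b => ⟨h.strictMono b, h.run_action_apply b, h.run_hasTag_iff b,
      fun t' ht' => TSO.Run.IsReschedule.exists_of_act_ne_null ht'⟩,
    fun j t => ⟨fun ht => ?_, fun ht => ?_⟩⟩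
  · rw [h.run_loc, TSO.Run.clock_newTime_of_mem Δ ht]
  · rw [h.run_loc, TSO.Run.clock_newTime_of_notMem Δ ht]
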